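/- Let $f\in\mathbb{C}[X_0,X_1,X_2]$ be a reduced (square-free) homogeneous polynomial of degree $d\ge 4$, let $X=V(f)\subset\mathbb{P}^2$ be the plane curve it defines, and put $f_i=\partial f/\partial X_i$ for $i=0,1,2$. Let $T\langle X\rangle\subset T_{\mathbb{P}^2}$ be the sheaf of logarithmic vector fields along $X$, that is, the sheaf of those $\mathbb{C}$-derivations of $\mathcal{O}_{\mathbb{P}^2}$ that map the ideal sheaf of $X$ into itself; equivalently, the kernel of the map $\eta:T_{\mathbb{P}^2}\to\mathcal{O}_X(d)$, $\sum_i A_i\,\partial/\partial X_i\mapsto\sum_i A_i f_i$. Then $T\langle X\rangle$ is stable if and only if $(f_0,f_1,f_2)$ has no syzygy of degree $\lfloor (d-1)/2\rfloor$, i.e. there is no triple $(a_0,a_1,a_2)\neq(0,0,0)$ of homogeneous polynomials of degree $\lfloor (d-1)/2\rfloor$ (the zero polynomial being allowed as an entry) with $a_0f_0+a_1f_1+a_2f_2=0$. In particular, $T\langle X\rangle$ is stable if $X$ is nonsingular. Here stability is slope stability (Mumford–Takemoto): every coherent subsheaf $F\subset T\langle X\rangle$ with $0<\operatorname{rk}F<\operatorname{rk}T\langle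 X\rangle$ satisfies $c_1(F)/\operatorname{rk}F<c_1(T\langle X\rangle)/\operatorname{rk}T\langle X\rangle$. -/

import Mathlib

open CategoryTheory AlgebraicGeometry TopologicalSpace Opposite

noncomputable section

namespace PlaneCurve

/-! ### The projective plane -/

/-- The homogeneous coordinate ring `ℂ[X₀, X₁, X₂]`. -/
abbrev CoordRing : Type := MvPolynomial (Fin 3) ℂ

/-- The standard grading of the homogeneous coordinate ring. -/
abbrev grading : ℕ → Submodule ℂ CoordRing := MvPolynomial.homogeneousSubmodule (Fin 3) ℂ

instance : GradedAlgebra grading := MvPolynomial.gradedAlgebra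

/-- The projective plane over `ℂ`, as a scheme. -/
abbrev P2 : Scheme.{0} := Proj grading

/-- The homogeneous prime ideal of `ℂ[X₀, X₁, X₂]` corresponding to a point of the plane. -/
abbrev pointIdeal (x : P2) : Ideal CoordRing :=
  HomogeneousIdeal.toIdeal (ProjectiveSpectrum.asHomogeneousIdeal x)

instance (x : P2) : (pointIdeal x).IsPrime := ProjectiveSpectrum.isPrime x

/-- The local ring of the plane at `x`: fractions `a / b` of homogeneous polynomials of the same
degree with `b` not in the prime ideal of `x`.  In Mathlib, the sections of the structure sheaf of
`Proj` over an open set `U` are the functions on `U` with values in these rings that are locally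
given by a single such fraction; `s.1 x` is the value (germ) of the section `s` at `x`. -/
abbrev LocalRing (x : P2) : Type := HomogeneousLocalization.AtPrime grading (pointIdeal x)

instance (x : P2) : Algebra ℂ (LocalRing x) where
  algebraMap := (HomogeneousLocalization.fromZeroRingHom grading (pointIdeal x).primeCompl).comp
    (algebraMap ℂ (grading 0))
  commutes' _ _ := mul_comm _ _
  smul_def' c s := by
    apply HomogeneousLocalization.val_injective
    rw [HomogeneousLocalization.val_smul, HomogeneousLocalization.val_mul]
    rw [Algebra.smul_def]
    rfl

/-- Constants as regular functions on an open set. -/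
def const (U : P2.Opens) : ℂ →+* Γ(P2, U) where
  toFun c := ⟨fun x : U => algebraMap ℂ (LocalRing x.1) c, fun x =>
    ⟨U, x.2, 𝟙 U, 0, algebraMap ℂ (grading 0) c, ⟨1, SetLike.GradedOne.one_mem⟩,
      fun y => (Ideal.ne_top_iff_one _).mp (ProjectiveSpectrum.isPrime y.1).ne_top,
      fun _ => rfl⟩⟩
  map_one' := Subtype.ext (funext fun x : U => map_one (algebraMap ℂ (LocalRing x.1)))
  map_mul' a b := Subtype.ext (funext fun x : U => map_mul (algebraMap ℂ (LocalRing x.1)) a b)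
  map_zero' := Subtype.ext (funext fun x : U => map_zero (algebraMap ℂ (LocalRing x.1)))
  map_add' a b := Subtype.ext (funext fun x : U => map_add (algebraMap ℂ (LocalRing x.1)) a b)

/-- The standard affine open set `Xᵢ ≠ 0`. -/
abbrev chart (i : Fin 3) : P2.Opens := Proj.basicOpen grading (MvPolynomial.X i)

/-- The regular function `Xⱼ / Xᵢ` on the open set `Xᵢ ≠ 0`. -/
def ratio (i j : Fin 3) : Γ(P2, chart i) :=
  ⟨fun x => .mk ⟨1, ⟨MvPolynomial.X j, MvPolynomial.isHomogeneous_X ℂ j⟩,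
      ⟨MvPolynomial.X i, MvPolynomial.isHomogeneous_X ℂ i⟩, x.2⟩,
    fun x => ⟨chart i, x.2, 𝟙 _, 1, ⟨MvPolynomial.X j, MvPolynomial.isHomogeneous_X ℂ j⟩,
      ⟨MvPolynomial.X i, MvPolynomial.isHomogeneous_X ℂ i⟩, fun y => y.2, fun _ => rfl⟩⟩

/-! ### The sheaf of logarithmic vector fields -/

/-- The stalk at `x` of the ideal sheaf of the curve `f = 0`: the elements of the local ring that
are multiples of `f` in the localization of the coordinate ring. -/
def curveIdeal (f : CoordRing) (x : P2) : Ideal (LocalRing x) :=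
  ((Ideal.span {f}).map
      (algebraMap CoordRing (Localization (pointIdeal x).primeCompl))).comap
    (algebraMap (LocalRing x) (Localization (pointIdeal x).primeCompl))

/-- A family of `ℂ`-derivations of the local rings at the points of `U` is a logarithmic vector
field on `U` along the curve `f = 0` if it maps regular functions on open subsets of `U` to regular
functions (that is, it is a derivation of the structure sheaf of `U`), and if it preserves the ideal
sheaf of the curve. -/
structure IsLogField (f : CoordRing) (U : P2.Opens)
    (D : ∀ x : U, Derivation ℂ (LocalRing x.1) (LocalRing x.1)) : Prop where
  regular : ∀ (V : P2.Opens) (hV : V ≤ U) (s : Γ(P2, V)),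
    ∃ t : Γ(P2, V), ∀ x : V, t.1 x = D ⟨x.1, hV x.2⟩ (s.1 x)
  preserves : ∀ (x : U), ∀ s ∈ curveIdeal f x.1, D x s ∈ curveIdeal f x.1

/-- The additive group of logarithmic vector fields on `U` along `f = 0`. -/
def logFields (f : CoordRing) (U : P2.Opens) :
    AddSubgroup (∀ x : U, Derivation ℂ (LocalRing x.1) (LocalRing x.1)) where
  carrier := {D | IsLogField f U D}
  zero_mem' := ⟨fun V _ _ => ⟨0, fun _ => rfl⟩, fun _ _ _ => Ideal.zero_mem _⟩
  add_mem' {D E} hD hE :=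
    ⟨fun V hV s => by
      obtain ⟨t, ht⟩ := hD.regular V hV s
      obtain ⟨u, hu⟩ := hE.regular V hV s
      exact ⟨t + u, fun x => (congrArg₂ (· + ·) (ht x) (hu x) :)⟩,
    fun x s hs => Ideal.add_mem _ (hD.preserves x s hs) (hE.preserves x s hs)⟩
  neg_mem' {D} hD :=
    ⟨fun V hV s => by
      obtain ⟨t, ht⟩ := hD.regular V hV s
      exact ⟨-t, fun x => (congrArg (- ·) (ht x) :)⟩,
    fun x s hs => neg_mem (hD.preserves x s hs)⟩

instance (f : CoordRing) (U : P2.Opens) : SMul Γ(P2, U) (logFields f U) where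
  smul r D := ⟨fun x => (r.1 x : LocalRing x.1) • D.1 x,
    fun V hV s => by
      obtain ⟨t, ht⟩ := D.2.regular V hV s
      exact ⟨P2.presheaf.map (homOfLE hV).op r * t,
        fun x => (congrArg ((r.1 ⟨x.1, hV x.2⟩ : LocalRing x.1) * ·) (ht x) :)⟩,
    fun x s hs => Ideal.mul_mem_left _ _ (D.2.preserves x s hs)⟩

instance (f : CoordRing) (U : P2.Opens) : Module Γ(P2, U) (logFields f U) where
  one_smul D := Subtype.ext (funext fun x => one_smul (LocalRing x.1) (D.1 x))
  mul_smul r s D :=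
    Subtype.ext (funext fun x => mul_smul (r.1 x : LocalRing x.1) (s.1 x : LocalRing x.1) (D.1 x))
  smul_zero r := Subtype.ext (funext fun x => smul_zero (r.1 x : LocalRing x.1))
  smul_add r D E :=
    Subtype.ext (funext fun x => smul_add (r.1 x : LocalRing x.1) (D.1 x) (E.1 x))
  add_smul r s D :=
    Subtype.ext (funext fun x => add_smul (r.1 x : LocalRing x.1) (s.1 x : LocalRing x.1) (D.1 x))
  zero_smul D := Subtype.ext (funext fun x => zero_smul (LocalRing x.1) (D.1 x))

/-- Restriction of logarithmic vector fields. -/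
def logRestrict (f : CoordRing) {U V : P2.Opens} (h : V ≤ U) : logFields f U →+ logFields f V where
  toFun D := ⟨fun x => D.1 ⟨x.1, h x.2⟩,
    fun W hW s => D.2.regular W (hW.trans h) s, fun x => D.2.preserves ⟨x.1, h x.2⟩⟩
  map_zero' := rfl
  map_add' _ _ := rfl

/-- The presheaf of abelian groups of logarithmic vector fields. -/
def logPresheaf (f : CoordRing) : TopCat.Presheaf Ab.{0} P2 where
  obj U := AddCommGrpCat.of (logFields f U.unop)
  map i := AddCommGrpCat.ofHom (logRestrict f i.unop.le)

theorem logPresheaf_isSheaf (f : CoordRing) : (logPresheaf f).IsSheaf := by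
  rw [TopCat.Presheaf.isSheaf_iff_isSheafUniqueGluing]
  intro ι U sf hsf
  have hmem : ∀ x : (iSup U : P2.Opens), ∃ i, x.1 ∈ U i := fun x => Opens.mem_iSup.mp x.2
  choose k hk using hmem
  let σ : ∀ i, logFields f (U i) := sf
  have hσ : ∀ (i j : ι) (x : P2) (hi : x ∈ U i) (hj : x ∈ U j),
      (σ i).1 ⟨x, hi⟩ = (σ j).1 ⟨x, hj⟩ := by
    intro i j x hi hj
    have h : logRestrict f (inf_le_left : U i ⊓ U j ≤ U i) (σ i)
        = logRestrict f (inf_le_right : U i ⊓ U j ≤ U j) (σ j) := hsf i j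
    exact congrArg (fun E : logFields f (U i ⊓ U j) => E.1 ⟨x, hi, hj⟩) h
  let D : ∀ x : (iSup U : P2.Opens), Derivation ℂ (LocalRing x.1) (LocalRing x.1) :=
    fun x => (σ (k x)).1 ⟨x.1, hk x⟩
  have hD : IsLogField f (iSup U) D := by
    refine ⟨fun V hV s => ?_, fun x => (σ (k x)).2.preserves ⟨x.1, hk x⟩⟩
    refine ⟨⟨fun x => D ⟨x.1, hV x.2⟩ (s.1 x), ?_⟩, fun x => rfl⟩
    refine (ProjectiveSpectrum.StructureSheaf.isLocallyFraction grading).locality _ fun x => ?_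
    let i := k ⟨x.1, hV x.2⟩
    have hi : x.1 ∈ U i := hk ⟨x.1, hV x.2⟩
    obtain ⟨t, ht⟩ := (σ i).2.regular (V ⊓ U i) inf_le_right
      (P2.presheaf.map (homOfLE (inf_le_left : V ⊓ U i ≤ V)).op s)
    refine ⟨V ⊓ U i, ⟨x.2, hi⟩, homOfLE inf_le_left, ?_⟩
    have h : (fun y : (V ⊓ U i : P2.Opens) => D ⟨y.1, hV y.2.1⟩ (s.1 ⟨y.1, y.2.1⟩)) = t.1 := by
      funext y
      refine Eq.trans ?_ (ht y).symm
      exact congrArg (fun E : Derivation ℂ (LocalRing y.1) (LocalRing y.1) =>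
        E (s.1 ⟨y.1, y.2.1⟩)) (hσ _ i y.1 _ y.2.2)
    exact h ▸ t.2
  refine ⟨(⟨D, hD⟩ : logFields f (iSup U)), fun i => ?_, fun E hE => ?_⟩
  · exact Subtype.ext (funext fun x => hσ _ i x.1 _ x.2)
  · refine Subtype.ext (funext fun x => ?_)
    have h : logRestrict f (le_iSup U (k x)) E = σ (k x) := hE (k x)
    exact congrArg (fun E : logFields f (U (k x)) => E.1 ⟨x.1, hk x⟩) h

instance (f : CoordRing) (U : P2.Opensᵒᵖ) :
    Module (P2.ringCatSheaf.obj.obj U) ((logPresheaf f).obj U) :=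
  inferInstanceAs (Module Γ(P2, U.unop) (logFields f U.unop))

/-- The sheaf `T⟨X⟩` of logarithmic vector fields along the plane curve `X` with equation `f = 0`,
as a sheaf of modules over the structure sheaf of the plane. -/
def logTangentSheaf (f : CoordRing) : P2.Modules :=
  SheafOfModules.mk (R := P2.ringCatSheaf)
    (PresheafOfModules.ofPresheaf (R := P2.ringCatSheaf.obj) (logPresheaf f)
      (fun _ _ _ _ _ => rfl))
    (logPresheaf_isSheaf f)

/-- The sections of `T⟨X⟩` over `U` are the logarithmic vector fields on `U`. -/
theorem logTangentSheaf_sections (f : CoordRing) (U : P2.Opens) :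
    (Γ(logTangentSheaf f, U) : Type) = logFields f U := rfl

/-! ### Coherent subsheaves, Hilbert polynomials, and slope stability -/

/-- Restriction of sections of a sheaf of modules. -/
abbrev res (E : P2.Modules) {U V : P2.Opens} (h : V ≤ U) (s : Γ(E, U)) : Γ(E, V) :=
  E.presheaf.map (homOfLE h).op s

/-- Sections of a sheaf of modules form complex vector spaces, through the constant functions. -/
instance (E : P2.Modules) (U : P2.Opens) : Module ℂ Γ(E, U) := Module.compHom _ (const U)

theorem res_const_smul (E : P2.Modules) {U V : P2.Opens} (h : V ≤ U) (c : ℂ) (s : Γ(E, U)) :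
    res E h (c • s) = c • res E h s :=
  E.map_smul (homOfLE h) (const U c) s

/-- A subsheaf of modules of a sheaf of modules. -/
structure Subsheaf (E : P2.Modules) where
  sections : ∀ U : P2.Opens, Submodule Γ(P2, U) Γ(E, U)
  res_mem : ∀ {U V : P2.Opens} (h : V ≤ U) (s : Γ(E, U)), s ∈ sections U → res E h s ∈ sections V
  locality : ∀ (U : P2.Opens) (s : Γ(E, U)),
    (∀ x ∈ U, ∃ (V : P2.Opens) (h : V ≤ U), x ∈ V ∧ res E h s ∈ sections V) → s ∈ sections U

/-- A sheaf of modules, as a subsheaf of itself. -/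
def Subsheaf.whole (E : P2.Modules) : Subsheaf E where
  sections _ := ⊤
  res_mem _ _ _ := trivial
  locality _ _ _ := trivial

/-- A subsheaf is of finite type if every point has an open neighbourhood `U` on which finitely
many sections generate it, that is, all its sections over open subsets of `U` are locally linear
combinations of those.  For a subsheaf of a coherent sheaf this means that it is coherent. -/
def Subsheaf.IsCoherent {E : P2.Modules} (F : Subsheaf E) : Prop :=
  ∀ x : P2, ∃ U : P2.Opens, x ∈ U ∧ ∃ (n : ℕ) (g : Fin n → Γ(E, U)), (∀ k, g k ∈ F.sections U) ∧
    ∀ (V : P2.Opens) (hV : V ≤ U), ∀ t ∈ F.sections V, ∀ y ∈ V,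
      ∃ (W : P2.Opens) (hW : W ≤ V), y ∈ W ∧
        res E hW t ∈ Submodule.span Γ(P2, W) (Set.range fun k => res E (hW.trans hV) (g k))

/-- The space of global sections `H⁰(F(m))` of the twist `F(m) = F ⊗ 𝒪(m)`.  As `𝒪(m)` is free on
the chart `Xᵢ ≠ 0` with generator `Xᵢ ^ m`, a global section of `F(m)` is a triple of sections
`sᵢ` of `F` on the charts such that `sᵢ ⊗ Xᵢ ^ m = sⱼ ⊗ Xⱼ ^ m`, that is,
`sᵢ = (Xⱼ / Xᵢ) ^ m • sⱼ`, on the intersections of the charts. -/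
def Subsheaf.twistedSections {E : P2.Modules} (F : Subsheaf E) (m : ℕ) :
    Submodule ℂ (∀ i : Fin 3, Γ(E, chart i)) where
  carrier := {s | (∀ i, s i ∈ F.sections (chart i)) ∧
    ∀ i j, res E (inf_le_left : chart i ⊓ chart j ≤ chart i) (s i) =
      P2.presheaf.map (homOfLE (inf_le_left : chart i ⊓ chart j ≤ chart i)).op (ratio i j ^ m) •
        res E (inf_le_right : chart i ⊓ chart j ≤ chart j) (s j)}
  zero_mem' := ⟨fun i => zero_mem _, fun i j => by simp [res]⟩
  add_mem' {s t} hs ht := ⟨fun i => add_mem (hs.1 i) (ht.1 i), fun i j => by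
    have h1 := hs.2 i j
    have h2 := ht.2 i j
    simp only [Pi.add_apply, res, map_add, smul_add] at h1 h2 ⊢
    rw [h1, h2]⟩
  smul_mem' c s hs := ⟨fun i => (F.sections (chart i)).smul_mem (const (chart i) c) (hs.1 i),
    fun i j => by
      have h : ∀ (U : P2.Opens) (r : Γ(P2, U)) (t : Γ(E, U)), c • r • t = r • c • t :=
        fun U r t => smul_comm (const U c) r t
      rw [Pi.smul_apply, Pi.smul_apply, res_const_smul, res_const_smul, hs.2 i j, h]⟩

/-- `p` is the Hilbert polynomial of `F`: it takes the value `dim H⁰(F(m))` at all large `m`. -/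
def Subsheaf.IsHilbertPolynomial {E : P2.Modules} (F : Subsheaf E) (p : Polynomial ℚ) : Prop :=
  ∀ᶠ m : ℕ in Filter.atTop, Module.Finite ℂ (F.twistedSections m) ∧
    (Module.finrank ℂ (F.twistedSections m) : ℚ) = p.eval (m : ℚ)

/-- The rank of a coherent sheaf on the plane with Hilbert polynomial `p = ∑ αₖ mᵏ / k!`: it is
`α₂ / α₂(𝒪)`, and `α₂(𝒪) = 1`. -/
def rank (p : Polynomial ℚ) : ℚ := 2 * p.coeff 2

/-- The degree, or first Chern class, of a coherent sheaf on the plane with Hilbert polynomial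
`p = ∑ αₖ mᵏ / k!`: it is `α₁ - rank * α₁(𝒪)`, and `α₁(𝒪) = 3 / 2`. -/
def degree (p : Polynomial ℚ) : ℚ := p.coeff 1 - rank p * (3 / 2)

/-- The slope of a coherent sheaf of positive rank with Hilbert polynomial `p`. -/
def slope (p : Polynomial ℚ) : ℚ := degree p / rank p

/-- Slope stability (in the sense of Mumford and Takemoto) of a torsion-free coherent sheaf on the
plane: every coherent subsheaf of strictly smaller positive rank has strictly smaller slope. -/
def IsStable (E : P2.Modules) : Prop :=
  ∃ p : Polynomial ℚ, (Subsheaf.whole E).IsHilbertPolynomial p ∧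
    ∀ F : Subsheaf E, F.IsCoherent → ∀ q : Polynomial ℚ, F.IsHilbertPolynomial q →
      0 < rank q → rank q < rank p → slope q < slope p

/-! ### Syzygies and smoothness -/

/-- The partial derivatives of `f` have a nonzero homogeneous syzygy of degree `e`. -/
def HasSyzygy (f : CoordRing) (e : ℕ) : Prop :=
  ∃ a : Fin 3 → CoordRing, (∀ i, (a i).IsHomogeneous e) ∧ a ≠ 0 ∧
    ∑ i, a i * MvPolynomial.pderiv i f = 0

/-- The plane curve `f = 0` is nonsingular: at each of its points some partial derivative of `f`
does not vanish. -/
def IsNonsingular (f : CoordRing) : Prop :=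
  ∀ v : Fin 3 → ℂ, v ≠ 0 → MvPolynomial.eval v f = 0 →
    ∃ i, MvPolynomial.eval v (MvPolynomial.pderiv i f) ≠ 0

end PlaneCurve

end

/-! The link between the sheaf and syzygies is Euler's relation. By the Euler sequence, a section of
T(m) is a field ∑ bⱼ∂ⱼ with forms bⱼ of degree m + 1, modulo multiples of the Euler field ∑ Xⱼ∂ⱼ. It
is logarithmic when f divides ∑ bⱼfⱼ. Since ∑ Xⱼfⱼ = d·f with d ≠ 0, exactly one multiple of the
Euler field can be subtracted to achieve ∑ bⱼfⱼ = 0. So H⁰(T⟨X⟩(m)) is the space of syzygies of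
degree m + 1 (`exists_syzygy_of_twistedSections`, `chartFields_injective`), and the twisted sections
of a subsheaf form subspaces of it, stable under multiplication by forms (`formSections_mul`).
Stability thus becomes a question about Hilbert functions. To get there, all germs are compared
inside the fraction field of the coordinate ring, where statements about different points become
identities between polynomials.

Slope of T⟨X⟩: as f is squarefree, the fᵢ have no common factor, so the quotient by their ideal has
a constant Hilbert function t in large degrees. Rank–nullity makes the Hilbert polynomial 3χ(𝒪(m +
1)) - χ(𝒪(m + d)) + t; the rank is 2 and the slope (3 - d)/2 (`exists_isHilbertPolynomial_whole`).

Subsheaves: a primitive syzygy of degree k generates a subsheaf with the Hilbert polynomial of 𝒪(1 -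
k). If all twisted sections of F are multiples of it, F has slope at most 1 - k; otherwise two
independent sections force rank at least 2. For e = ⌊(d - 1)/2⌋ one has 2e + 1 ≤ d ≤ 2e + 2, so 1 -
k ≥ (3 - d)/2 when k ≤ e, and 1 - k < (3 - d)/2 when k > e (`not_isStable_of_hasSyzygy`,
`slope_lt_of_not_hasSyzygy`).

Nonsingular curves: the fᵢ vanish together only at the origin, so by the Nullstellensatz their ideal
contains powers of the variables. Then all syzygies are Koszul, and nonzero homogeneous ones have
degree at least d - 1 > e (`not_hasSyzygy_of_isNonsingular`). -/

noncomputable section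

namespace PlaneCurve

open MvPolynomial

/-! ### Syzygies of three elements -/

section Syzygies

variable {R : Type*} [CommRing R] [IsDomain R]

/-- A syzygy of a regular sequence of length three is a combination of Koszul syzygies. -/
theorem exists_koszul [DecompositionMonoid R] {x y z : R} (hx : x ≠ 0) (hxy : IsRelPrime x y)
    (hz : ∀ u, z * u ∈ Ideal.span {x, y} → u ∈ Ideal.span {x, y}) {u v w : R}
    (h : u * x + v * y + w * z = 0) :
    ∃ a b c, u = b * z - c * y ∧ v = c * x - a * z ∧ w = a * y - b * x := by
  have hw : w ∈ Ideal.span {x, y} :=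
    hz w (Ideal.mem_span_pair.mpr ⟨-u, -v, by linear_combination (-1) * h⟩)
  obtain ⟨p, q, hpq⟩ := Ideal.mem_span_pair.mp hw
  -- Substituting w = p x + q y gives (u + p z) x + (v + q z) y = 0, a relation between two coprime
  -- elements.
  have h2 : x ∣ y * (v + q * z) := ⟨-(u + p * z), by linear_combination h + z * hpq⟩
  obtain ⟨c, hc⟩ := hxy.dvd_of_dvd_mul_left h2
  refine ⟨q, -p, c, mul_left_cancel₀ hx ?_, by linear_combination hc, by
    linear_combination -hpq⟩
  linear_combination h + z * hpq - y * hc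

/-- If `a` divides all products `v * F j` and the `F j` have no common prime factor, then
`a` divides `v`. -/
theorem dvd_of_forall_dvd_mul [UniqueFactorizationMonoid R] {ι : Type*} {F : ι → R}
    (hF : ∀ p, Prime p → ∃ i, ¬ p ∣ F i) {a : R} (ha : a ≠ 0) :
    ∀ {v : R}, (∀ j, a ∣ v * F j) → a ∣ v := by
  induction a using UniqueFactorizationMonoid.induction_on_prime with
  | h₁ => exact absurd rfl ha
  | h₂ x hx => exact fun _ => hx.dvd
  | h₃ a p ha0 hp ih =>
    intro v hv
    obtain ⟨i, hi⟩ := hF p hp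
    -- Some F i is prime to p, so p divides v; cancelling p leaves the same problem for the
    -- remaining factor of the divisor.
    obtain ⟨v, rfl⟩ := (hp.dvd_or_dvd ((dvd_mul_right p a).trans (hv i))).resolve_right hi
    refine mul_dvd_mul_left p (ih ha0 fun j => ?_)
    have := hv j
    rw [mul_assoc] at this
    exact (mul_dvd_mul_iff_left hp.ne_zero).mp this

/-- A vector proportional to a primitive vector is a multiple of it. -/
theorem exists_eq_mul_of_proportional [UniqueFactorizationMonoid R] {ι : Type*} {F v : ι → R}
    (hF : ∀ p, Prime p → ∃ i, ¬ p ∣ F i) {i : ι} (hi : F i ≠ 0)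
    (h : ∀ j k, v j * F k = v k * F j) : ∃ w, ∀ j, v j = w * F j := by
  obtain ⟨w, hw⟩ := dvd_of_forall_dvd_mul hF hi (v := v i) fun j => ⟨v j, by
    rw [← h j i, mul_comm]⟩
  refine ⟨w, fun j => mul_left_cancel₀ hi ?_⟩
  linear_combination h j i + F j * hw

end Syzygies

/-! ### Koszul relations and powers of the variables. -/

theorem forall_fin_three_of_symm {P : Fin 3 → Fin 3 → Prop} (hr : ∀ i, P i i)
    (hs : ∀ i j, P i j → P j i) (h01 : P 0 1) (h12 : P 1 2) (h20 : P 2 0) : ∀ i j, P i j := by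
  simp only [Fin.forall_fin_succ, Fin.forall_fin_zero, and_true]
  exact ⟨⟨hr _, h01, hs _ _ h20⟩, ⟨hs _ _ h01, hr _, h12⟩, h20, hs _ _ h12, hr _⟩

theorem not_X_dvd_X {i j : Fin 3} (h : i ≠ j) : ¬ (X i : CoordRing) ∣ X j := by
  rw [X_dvd_X]; exact h

theorem isRelPrime_X_pow {i j : Fin 3} (h : i ≠ j) (m n : ℕ) :
    IsRelPrime (X i ^ m : CoordRing) (X j ^ n) :=
  (((X_prime (R := ℂ) (i := i)).irreducible.isRelPrime_iff_not_dvd).mpr (not_X_dvd_X h)).pow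

/-- Membership in a monomial ideal is tested monomial by monomial, and a factor X₂ ^ n leaves the
exponents of X₀ and X₁ unchanged. This is the third regularity condition in `exists_koszul`. -/
theorem mem_span_X_pow_pair_of_mul (n : ℕ) (u : CoordRing)
    (h : X 2 ^ n * u ∈ Ideal.span {(X 0 ^ n : CoordRing), X 1 ^ n}) :
    u ∈ Ideal.span {(X 0 ^ n : CoordRing), X 1 ^ n} := by
  have hs : ({(X 0 ^ n : CoordRing), X 1 ^ n} : Set CoordRing) =
      (fun s => monomial s 1) '' {Finsupp.single 0 n, Finsupp.single 1 n} := by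
    simp [Set.image_pair, X_pow_eq_monomial]
  rw [hs, mem_ideal_span_monomial_image] at h ⊢
  intro s hs
  have hmem : Finsupp.single 2 n + s ∈ (X 2 ^ n * u).support := by
    rw [mem_support_iff, X_pow_eq_monomial, coeff_monomial_mul, one_mul]
    exact mem_support_iff.mp hs
  obtain ⟨t, ht, hle⟩ := h _ hmem
  refine ⟨t, ht, ?_⟩
  rcases ht with rfl | rfl <;> rw [Finsupp.single_le_iff] at hle ⊢ <;> simpa using hle

/-- Exactness of the Koszul complex of `X₀ ^ n, X₁ ^ n, X₂ ^ n` in the middle. -/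
theorem exists_koszul_X_pow (n : ℕ) {u v w : CoordRing}
    (h : u * X 0 ^ n + v * X 1 ^ n + w * X 2 ^ n = 0) :
    ∃ a b c, u = b * X 2 ^ n - c * X 1 ^ n ∧ v = c * X 0 ^ n - a * X 2 ^ n ∧
      w = a * X 1 ^ n - b * X 0 ^ n :=
  exists_koszul (pow_ne_zero _ (X_ne_zero 0)) (isRelPrime_X_pow (by decide) n n)
    (mem_span_X_pow_pair_of_mul n) h

/-- As X₀ ^ n is prime to X₁ ^ n, it divides v 0; the quotient serves for all i. This is the gluing
of local solutions v i / X i ^ n. -/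
theorem exists_eq_X_pow_mul (n : ℕ) {v : Fin 3 → CoordRing}
    (h : ∀ i j, X j ^ n * v i = X i ^ n * v j) : ∃ w, ∀ i, v i = X i ^ n * w := by
  obtain ⟨w, hw⟩ := (isRelPrime_X_pow (i := 0) (j := 1) (by decide) n n).dvd_of_dvd_mul_left
    (Dvd.intro _ (h 0 1).symm)
  refine ⟨w, fun i => mul_left_cancel₀ (pow_ne_zero n (X_ne_zero (R := ℂ) (0 : Fin 3))) ?_⟩
  rw [h i 0, hw]; ring

/-- If an ideal generated by three polynomials contains powers of all variables, then these
polynomials have no common prime factor. -/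
theorem exists_not_dvd_of_X_pow {F : Fin 3 → CoordRing} {n : ℕ} {g : Fin 3 → Fin 3 → CoordRing}
    (hg : ∀ i, ∑ j, g i j * F j = X i ^ n) (p : CoordRing) (hp : Prime p) : ∃ i, ¬ p ∣ F i := by
  by_contra! h
  have hX : ∀ i, p ∣ X i ^ n := fun i =>
    hg i ▸ Finset.dvd_sum fun j _ => (h j).mul_left _
  exact hp.not_isUnit (isRelPrime_X_pow (i := 0) (j := 1) (by decide) n n (hX 0) (hX 1))

/-- If the ideal generated by three polynomials contains powers of all variables, then their
syzygies are Koszul syzygies. -/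
theorem exists_cross_of_syzygy {F : Fin 3 → CoordRing} {n : ℕ} {g : Fin 3 → Fin 3 → CoordRing}
    (hg : ∀ i, ∑ j, g i j * F j = X i ^ n) {a : Fin 3 → CoordRing}
    (ha : ∑ j, a j * F j = 0) :
    ∃ c : Fin 3 → CoordRing, a 0 = c 1 * F 2 - c 2 * F 1 ∧ a 1 = c 2 * F 0 - c 0 * F 2 ∧
      a 2 = c 0 * F 1 - c 1 * F 0 := by
  have hprim := exists_not_dvd_of_X_pow hg
  obtain ⟨i₀, hi₀⟩ : ∃ i, F i ≠ 0 := by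
    obtain ⟨i, hi⟩ := hprim (X 0) X_prime
    exact ⟨i, fun h => hi (h ▸ dvd_zero _)⟩
  simp only [Fin.sum_univ_three] at hg ha
  -- c i is the cross product g i × a, a solution after multiplication by X i ^ n: (g i × a) × F =
  -- (g i · F) a - (a · F) g i = X i ^ n a.
  let c : Fin 3 → Fin 3 → CoordRing := fun i =>
    ![g i 1 * a 2 - g i 2 * a 1, g i 2 * a 0 - g i 0 * a 2, g i 0 * a 1 - g i 1 * a 0]
  have hc0 : ∀ i, X i ^ n * a 0 = c i 1 * F 2 - c i 2 * F 1 := fun i => by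
    rw [← hg i]; simp only [c, Matrix.cons_val]; linear_combination g i 0 * ha
  have hc1 : ∀ i, X i ^ n * a 1 = c i 2 * F 0 - c i 0 * F 2 := fun i => by
    rw [← hg i]; simp only [c, Matrix.cons_val]; linear_combination g i 1 * ha
  have hc2 : ∀ i, X i ^ n * a 2 = c i 0 * F 1 - c i 1 * F 0 := fun i => by
    rw [← hg i]; simp only [c, Matrix.cons_val]; linear_combination g i 2 * ha
  -- On overlaps, two such solutions differ by a vector whose cross product with F vanishes, hence
  -- by a multiple of the primitive vector F.
  have hw : ∀ i j, ∃ w, ∀ k, X j ^ n * c i k - X i ^ n * c j k = w * F k := fun i j => by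
    refine exists_eq_mul_of_proportional hprim hi₀ fun k l => ?_
    have h0 : (X j ^ n * c i 1 - X i ^ n * c j 1) * F 2 =
        (X j ^ n * c i 2 - X i ^ n * c j 2) * F 1 := by
      linear_combination (-X j ^ n) * hc0 i + X i ^ n * hc0 j
    have h1 : (X j ^ n * c i 2 - X i ^ n * c j 2) * F 0 =
        (X j ^ n * c i 0 - X i ^ n * c j 0) * F 2 := by
      linear_combination (-X j ^ n) * hc1 i + X i ^ n * hc1 j
    have h2 : (X j ^ n * c i 0 - X i ^ n * c j 0) * F 1 =
        (X j ^ n * c i 1 - X i ^ n * c j 1) * F 0 := by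
      linear_combination (-X j ^ n) * hc2 i + X i ^ n * hc2 j
    exact forall_fin_three_of_symm
      (P := fun k l => (X j ^ n * c i k - X i ^ n * c j k) * F l =
        (X j ^ n * c i l - X i ^ n * c j l) * F k)
      (fun _ => rfl) (fun _ _ h => h.symm) h2 h0 h1 k l
  choose w hw using hw
  -- The multipliers w form a cocycle. Koszul exactness for the X i ^ n makes it the coboundary of
  -- e, and the corrected vectors c i - e i F then glue to one solution u.
  have hcocycle : w 1 2 * X 0 ^ n + w 2 0 * X 1 ^ n + w 0 1 * X 2 ^ n = 0 := by
    refine mul_right_cancel₀ hi₀ ?_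
    linear_combination -X 0 ^ n * hw 1 2 i₀ - X 1 ^ n * hw 2 0 i₀ - X 2 ^ n * hw 0 1 i₀
  obtain ⟨e₀, e₁, e₂, h12, h20, h01⟩ := exists_koszul_X_pow n hcocycle
  let e : Fin 3 → CoordRing := ![e₀, e₁, e₂]
  have key : ∀ k, ∃ u, ∀ i, c i k - e i * F k = X i ^ n * u := fun k => by
    refine exists_eq_X_pow_mul n (v := fun i => c i k - e i * F k) fun i j => ?_
    have h01' : X 1 ^ n * (c 0 k - e₀ * F k) = X 0 ^ n * (c 1 k - e₁ * F k) := by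
      linear_combination hw 0 1 k + F k * h01
    have h12' : X 2 ^ n * (c 1 k - e₁ * F k) = X 1 ^ n * (c 2 k - e₂ * F k) := by
      linear_combination hw 1 2 k + F k * h12
    have h20' : X 0 ^ n * (c 2 k - e₂ * F k) = X 2 ^ n * (c 0 k - e₀ * F k) := by
      linear_combination hw 2 0 k + F k * h20
    exact forall_fin_three_of_symm
      (P := fun i j => X j ^ n * (c i k - e i * F k) = X i ^ n * (c j k - e j * F k))
      (fun _ => rfl) (fun _ _ h => h.symm) h01' h12' h20' i j
  choose u hu using key
  have hX : (X 0 ^ n : CoordRing) ≠ 0 := pow_ne_zero n (X_ne_zero 0)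
  refine ⟨u, mul_left_cancel₀ hX ?_, mul_left_cancel₀ hX ?_, mul_left_cancel₀ hX ?_⟩
  · linear_combination hc0 0 + F 2 * hu 1 0 - F 1 * hu 2 0
  · linear_combination hc1 0 + F 0 * hu 2 0 - F 2 * hu 0 0
  · linear_combination hc2 0 + F 1 * hu 0 0 - F 0 * hu 1 0

/-! ### Homogeneous components -/

theorem decompose_eq_homogeneousComponent (p : CoordRing) (n : ℕ) :
    (DirectSum.decompose grading p n : CoordRing) = homogeneousComponent n p :=
  decomposition.decompose'_apply p n

theorem homogeneousComponent_mul_of_le {p q : CoordRing} {e n : ℕ} (hq : q.IsHomogeneous e)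
    (h : e ≤ n) :
    homogeneousComponent n (p * q) = homogeneousComponent (n - e) p * q := by
  have := DirectSum.coe_decompose_mul_of_right_mem_of_le (n := n) grading (a := p) (b := q) hq h
  simpa only [decompose_eq_homogeneousComponent] using this

theorem homogeneousComponent_mul_of_lt {p q : CoordRing} {e n : ℕ} (hq : q.IsHomogeneous e)
    (h : n < e) : homogeneousComponent n (p * q) = 0 := by
  have := DirectSum.coe_decompose_mul_of_right_mem_of_not_le (n := n) grading (a := p) (b := q) hq
    (not_le.mpr h)
  simpa only [decompose_eq_homogeneousComponent] using this

theorem isHomogeneous_of_mul {p q : CoordRing} {e n : ℕ} (hq : q.IsHomogeneous e)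
    (h : (p * q).IsHomogeneous (n + e)) (hq0 : q ≠ 0) : p.IsHomogeneous n := by
  have h1 : homogeneousComponent n p * q = p * q := by
    conv_rhs => rw [← homogeneousComponent_eq_self h]
    rw [homogeneousComponent_mul_of_le hq (Nat.le_add_left e n), Nat.add_sub_cancel]
  rw [← mul_right_cancel₀ hq0 h1]
  exact homogeneousComponent_isHomogeneous n p

/-! ### Partial derivatives -/

theorem totalDegree_pderiv_lt {p : CoordRing} {i : Fin 3} (h : pderiv i p ≠ 0) :
    (pderiv i p).totalDegree < p.totalDegree := by
  obtain ⟨m, hm, hdeg⟩ := Finset.exists_mem_eq_sup (pderiv i p).support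
    (support_nonempty.mpr h) (fun s => s.sum fun _ e => e)
  rw [totalDegree, hdeg]
  have hc : coeff (m + Finsupp.single i 1) p ≠ 0 := fun h0 => by
    rw [mem_support_iff, coeff_pderiv, h0, zero_mul] at hm
    exact hm rfl
  have := le_totalDegree (mem_support_iff.mpr hc)
  rw [Finsupp.sum_add_index' (fun _ => rfl) (fun _ _ _ => rfl),
    Finsupp.sum_single_index rfl] at this
  omega

theorem eq_C_of_pderiv_eq_zero {p : CoordRing} (h : ∀ i, pderiv i p = 0) : p = C (coeff 0 p) := by
  ext m
  rw [coeff_C]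
  split_ifs with h0
  · rw [h0]
  · obtain ⟨i, hi⟩ : ∃ i, m i ≠ 0 := by
      by_contra! hm
      exact h0 (Finsupp.ext fun i => (hm i).symm)
    have h1 := congrArg (coeff (m - Finsupp.single i 1)) (h i)
    rw [coeff_pderiv, coeff_zero, tsub_add_cancel_of_le (by
      rw [Finsupp.single_le_iff]; omega)] at h1
    refine (mul_eq_zero.mp h1).resolve_right ?_
    exact Nat.cast_add_one_ne_zero _

/-- The partial derivatives of a squarefree homogeneous polynomial of positive degree have no common
prime factor. -/
theorem exists_not_dvd_pderiv {d : ℕ} (hd : d ≠ 0) {f : CoordRing} (hhom : f.IsHomogeneous d)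
    (hred : Squarefree f) (p : CoordRing) (hp : Prime p) : ∃ i, ¬ p ∣ pderiv i f := by
  by_contra! h
  -- Euler's relation: p divides ∑ Xᵢ∂ᵢf = d f, and d is a unit in ℂ.
  obtain ⟨g, rfl⟩ : p ∣ f := by
    have h1 : p ∣ d • f := hhom.sum_X_mul_pderiv ▸ Finset.dvd_sum fun i _ => (h i).mul_left _
    rw [← Nat.cast_smul_eq_nsmul ℂ, smul_eq_C_mul] at h1
    exact ((isUnit_iff_ne_zero.mpr (Nat.cast_ne_zero.mpr hd)).map C).dvd_mul_left.mp h1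
  -- If p did not divide g, then p ∣ ∂ᵢ(p g) would force p ∣ ∂ᵢp, so ∂ᵢp = 0 by degree and p would
  -- be constant. Hence p² divides f, against squarefreeness.
  have hg : p ∣ g := by
    by_contra hg
    refine hp.not_isUnit ?_
    have h0 : ∀ i, pderiv i p = 0 := fun i => by
      by_contra hi
      have h1 : p ∣ pderiv i p := by
        have h2 := h i
        rw [pderiv_mul, dvd_add_left (dvd_mul_right p _)] at h2
        exact (hp.dvd_or_dvd h2).resolve_right hg
      obtain ⟨q, hq⟩ := h1
      have hlt := totalDegree_pderiv_lt hi
      rw [hq, totalDegree_mul_of_isDomain hp.ne_zero (fun hq0 => hi (by rw [hq, hq0, mul_zero]))]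
        at hlt
      omega
    rw [eq_C_of_pderiv_eq_zero h0]
    refine (isUnit_iff_ne_zero.mpr fun hc => hp.ne_zero ?_).map C
    rw [eq_C_of_pderiv_eq_zero h0, hc, C_0]
  obtain ⟨k, rfl⟩ := hg
  exact hp.not_isUnit (hred p ⟨k, by ring⟩)

theorem eval_eq_zero_of_pderiv {d : ℕ} (hd : d ≠ 0) {f : CoordRing} (hhom : f.IsHomogeneous d)
    {v : Fin 3 → ℂ} (h : ∀ i, eval v (pderiv i f) = 0) : eval v f = 0 := by
  have h1 := congrArg (eval v) hhom.sum_X_mul_pderiv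
  rw [map_sum, map_nsmul, Finset.sum_eq_zero fun i _ => by rw [map_mul, h, mul_zero]] at h1
  exact (smul_eq_zero.mp h1.symm).resolve_left hd

/-- The partial derivatives of the equation of a nonsingular curve generate an ideal that contains
powers of all variables. -/
theorem exists_X_pow_of_isNonsingular {d : ℕ} (hd : d ≠ 0) {f : CoordRing}
    (hhom : f.IsHomogeneous d) (h : IsNonsingular f) :
    ∃ (n : ℕ) (g : Fin 3 → Fin 3 → CoordRing), ∀ i, ∑ j, g i j * pderiv j f = X i ^ n := by
  let J : Ideal CoordRing := Ideal.span (Set.range fun j => pderiv j f)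
  -- By Euler's relation a common zero of the partial derivatives lies on the curve, so
  -- nonsingularity leaves only the origin, where every variable vanishes.
  have hX : ∀ i, (X i : CoordRing) ∈ J.radical := fun i => by
    rw [← vanishingIdeal_zeroLocus_eq_radical (K := ℂ), mem_vanishingIdeal_iff]
    intro v hv
    have hv' : ∀ j, eval v (pderiv j f) = 0 := fun j =>
      mem_zeroLocus_iff.mp hv _ (Ideal.subset_span ⟨j, rfl⟩)
    have hv0 : v = 0 := by
      by_contra hv0
      obtain ⟨j, hj⟩ := h v hv0 (eval_eq_zero_of_pderiv hd hhom hv')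
      exact hj (hv' j)
    simp [hv0]
  choose n hn using hX
  have hn' : ∀ i, (X i : CoordRing) ^ (∑ j, n j) ∈ J := fun i =>
    J.mem_of_dvd (pow_dvd_pow _ (Finset.single_le_sum (f := n) (fun _ _ => Nat.zero_le _)
      (Finset.mem_univ i))) (hn i)
  choose g hg using fun i => Ideal.mem_span_range_iff_exists_fun.mp (hn' i)
  exact ⟨_, g, hg⟩

/-- The entries of a Koszul syzygy lie in the ideal of the partial derivatives, which are forms of
degree d - 1 > e; their components of degree e therefore vanish. -/
theorem not_hasSyzygy_of_isNonsingular {d e : ℕ} (hd : e + 1 < d) {f : CoordRing}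
    (hhom : f.IsHomogeneous d) (h : IsNonsingular f) : ¬ HasSyzygy f e := by
  rintro ⟨a, ha, ha0, hsyz⟩
  obtain ⟨n, g, hg⟩ := exists_X_pow_of_isNonsingular (by omega) hhom h
  obtain ⟨c, h0, h1, h2⟩ := exists_cross_of_syzygy hg hsyz
  have hz : ∀ (p : CoordRing) j, homogeneousComponent e (p * pderiv j f) = 0 := fun p j =>
    homogeneousComponent_mul_of_lt hhom.pderiv (by omega)
  refine ha0 (funext fun i => ?_)
  rw [← homogeneousComponent_eq_self (ha i)]
  fin_cases i
  · simp only [Fin.zero_eta, h0, map_sub, hz, sub_zero, Pi.zero_apply]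
  · simp only [Fin.mk_one, h1, map_sub, hz, sub_zero, Pi.zero_apply]
  · simp only [Fin.reduceFinMk, h2, map_sub, hz, sub_zero, Pi.zero_apply]

/-! ### Dimensions of graded pieces -/

theorem finrank_homogeneousSubmodule (n : ℕ) :
    Module.finrank ℂ (homogeneousSubmodule (Fin 3) ℂ n) = (n + 2).choose 2 := by
  rw [homogeneousSubmodule_eq_finsupp_supported]
  rw [(AddMonoidAlgebra.supportedEquivFinsupp (S := ℂ) (R := ℂ)
    {d : Fin 3 →₀ ℕ | d.degree = n}).finrank_eq]
  have hs : {d : Fin 3 →₀ ℕ | d.degree = n} =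
      (Finset.univ.finsuppAntidiag n : Finset (Fin 3 →₀ ℕ)) := by
    ext d
    simp [Finset.mem_finsuppAntidiag, Finsupp.degree_eq_sum]
  rw [hs, Module.finrank_finsupp_self, ← Nat.card_eq_fintype_card, Nat.card_coe_set_eq,
    Set.ncard_coe_finset,
    Finset.card_finsuppAntidiag_nat_eq_choose, Finset.card_univ, Fintype.card_fin,
    ← Nat.choose_symm (by omega)]
  congr 1 <;> omega

instance (n : ℕ) : Module.Finite ℂ (homogeneousSubmodule (Fin 3) ℂ n) :=
  Module.Finite.iff_fg.mpr (homogeneousSubmodule_fg (Fin 3) ℂ n)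

/-! ### Hilbert functions -/

/-- The homogeneous elements of degree `n` of an ideal. -/
def gradedPart (I : Ideal CoordRing) (n : ℕ) : Submodule ℂ (homogeneousSubmodule (Fin 3) ℂ n) :=
  (I.restrictScalars ℂ).comap (homogeneousSubmodule (Fin 3) ℂ n).subtype

theorem mem_gradedPart {I : Ideal CoordRing} {n : ℕ} {u : homogeneousSubmodule (Fin 3) ℂ n} :
    u ∈ gradedPart I n ↔ (u : CoordRing) ∈ I := Iff.rfl

/-- Multiplication by a homogeneous polynomial. -/
def mulHom {p : CoordRing} {e : ℕ} (hp : p.IsHomogeneous e) (n : ℕ) :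
    homogeneousSubmodule (Fin 3) ℂ n →ₗ[ℂ] homogeneousSubmodule (Fin 3) ℂ (n + e) where
  toFun u := ⟨u * p, u.2.mul hp⟩
  map_add' _ _ := Subtype.ext (add_mul _ _ _)
  map_smul' c _ := Subtype.ext (smul_mul_assoc c _ _)

/-- The upper bound of Bézout's theorem. The Koszul complex of the coprime forms p, q bounds the
dimension by that of the degree k + 2e part, minus twice that of degree k + e, plus that of degree
k, which is e². -/
theorem finrank_quotient_le {p q : CoordRing} {e : ℕ} (hp : p.IsHomogeneous e)
    (hq : q.IsHomogeneous e) (hp0 : p ≠ 0) (hpq : IsRelPrime p q) {I : Ideal CoordRing}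
    (hpI : p ∈ I) (hqI : q ∈ I) (k : ℕ) :
    Module.finrank ℂ (homogeneousSubmodule (Fin 3) ℂ (k + e + e) ⧸ gradedPart I (k + e + e)) ≤
      e ^ 2 := by
  let φ := (mulHom hp (k + e)).coprod (mulHom hq (k + e))
  let ψ := (mulHom hq k).prod (-mulHom hp k)
  have hφ : LinearMap.range φ ≤ gradedPart I (k + e + e) := by
    rintro _ ⟨⟨u, v⟩, rfl⟩
    exact I.add_mem (I.mul_mem_left _ hpI) (I.mul_mem_left _ hqI)
  have hψ : LinearMap.ker φ ≤ LinearMap.range ψ := by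
    rintro ⟨u, v⟩ huv
    have h : (u : CoordRing) * p + v * q = 0 := congrArg Subtype.val huv
    obtain ⟨w, hw⟩ := hpq.dvd_of_dvd_mul_right (y := (v : CoordRing)) ⟨-u, by
      linear_combination h⟩
    have hwk : (-w).IsHomogeneous k := by
      refine (isHomogeneous_of_mul hp ?_ hp0)
      rw [neg_mul, mul_comm, ← hw]
      exact v.2.neg
    refine ⟨⟨-w, hwk⟩, Prod.ext (Subtype.ext ?_) (Subtype.ext ?_)⟩
    · refine mul_right_cancel₀ hp0 ?_
      change -w * q * p = u * p
      linear_combination (-1) * h + q * hw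
    · change -(-w * p) = v
      rw [hw]; ring
  have h1 := (gradedPart I (k + e + e)).finrank_quotient_add_finrank
  have h2 := Submodule.finrank_mono hφ
  have h3 := Submodule.finrank_mono hψ
  have h4 := LinearMap.finrank_range_le ψ
  have h5 := LinearMap.finrank_range_add_finrank_ker φ
  rw [Module.finrank_prod] at h5
  simp only [finrank_homogeneousSubmodule] at h1 h4 h5
  have key : (k + e + e + 2).choose 2 + (k + 2).choose 2 = 2 * (k + e + 2).choose 2 + e ^ 2 := by
    rify
    simp only [Nat.cast_choose_two]
    push_cast
    ring
  omega

/-- Some combinations of polynomials without common prime factors are relatively prime. -/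
theorem exists_isRelPrime {F : Fin 3 → CoordRing} (hF : ∀ p, Prime p → ∃ i, ¬ p ∣ F i) {e : ℕ}
    (hhom : ∀ i, (F i).IsHomogeneous e) :
    ∃ p q : CoordRing, p.IsHomogeneous e ∧ q.IsHomogeneous e ∧ p ≠ 0 ∧ IsRelPrime p q ∧
      p ∈ Ideal.span (Set.range F) ∧ q ∈ Ideal.span (Set.range F) := by
  classical
  obtain ⟨i, hi⟩ : ∃ i, F i ≠ 0 := by
    obtain ⟨i, hi⟩ := hF (X 0) X_prime
    exact ⟨i, fun h => hi (h ▸ dvd_zero _)⟩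
  let L : (Fin 3 → ℂ) →ₗ[ℂ] CoordRing := Fintype.linearCombination ℂ F
  let W : CoordRing → Submodule ℂ (Fin 3 → ℂ) := fun g =>
    ((Ideal.span {g}).restrictScalars ℂ).comap L
  have hL : ∀ c, L c = ∑ j, c j • F j := fun c => rfl
  have hW : ∀ g c, c ∈ W g ↔ g ∣ L c := fun g c => Ideal.mem_span_singleton
  -- For each prime factor g of F i, the coefficient vectors of combinations divisible by g form a
  -- proper subspace of ℂ³; finitely many of these cannot cover it.
  let s := (UniqueFactorizationMonoid.factors (F i)).toFinset.image W
  have hs : ⊤ ∉ s := by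
    intro htop
    obtain ⟨g, hg, hgW⟩ := Finset.mem_image.mp htop
    obtain ⟨j, hj⟩ := hF g
      (UniqueFactorizationMonoid.prime_of_factor g (Multiset.mem_toFinset.mp hg))
    refine hj ?_
    have := (hW g (Pi.single j 1)).mp (hgW ▸ Submodule.mem_top)
    simpa [L] using this
  obtain ⟨c, hc⟩ := (Set.ne_univ_iff_exists_notMem _).mp
    (Subspace.biUnion_ne_univ_of_top_notMem hs)
  refine ⟨F i, L c, hhom i, ?_, hi, ?_, Ideal.subset_span ⟨i, rfl⟩, ?_⟩
  · rw [hL]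
    exact IsHomogeneous.sum _ _ _ fun j _ => (homogeneousSubmodule (Fin 3) ℂ e).smul_mem _ (hhom j)
  · refine (UniqueFactorizationMonoid.isRelPrime_iff_no_prime_factors hi).mpr fun g h1 h2 hg => ?_
    obtain ⟨g', hg', hass⟩ :=
      UniqueFactorizationMonoid.exists_mem_factors_of_dvd hi hg.irreducible h1
    refine hc (Set.mem_biUnion (x := W g') ?_ ((hW g' c).mpr (hass.symm.dvd.trans h2)))
    exact Finset.mem_image_of_mem W (Multiset.mem_toFinset.mpr hg')
  · rw [hL]
    exact Ideal.sum_mem _ fun j _ => by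
      rw [smul_eq_C_mul]
      exact Ideal.mul_mem_left _ _ (Ideal.subset_span ⟨j, rfl⟩)

/-- Some linear form avoids all primes in a finite set that do not contain all variables. -/
theorem exists_linear_notMem {s : Set (Ideal CoordRing)} (hs : s.Finite) :
    ∃ l : CoordRing, l.IsHomogeneous 1 ∧ ∀ P ∈ s, l ∈ P → ∀ i, X i ∈ P := by
  classical
  let L : (Fin 3 → ℂ) →ₗ[ℂ] CoordRing := Fintype.linearCombination ℂ X
  let W : Ideal CoordRing → Submodule ℂ (Fin 3 → ℂ) := fun P => (P.restrictScalars ℂ).comap L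
  -- A prime whose subspace is everything contains all variables. Such primes are erased, so that
  -- only proper subspaces have to be avoided.
  obtain ⟨c, hc⟩ := (Set.ne_univ_iff_exists_notMem _).mp
    (Subspace.biUnion_ne_univ_of_top_notMem (s := (hs.toFinset.image W).erase ⊤) (by simp))
  refine ⟨L c, ?_, fun P hP hlP => ?_⟩
  · exact IsHomogeneous.sum _ _ _ fun j _ =>
      (homogeneousSubmodule (Fin 3) ℂ 1).smul_mem _ (isHomogeneous_X ℂ j)
  · have htop : W P = ⊤ := by
      by_contra hne
      refine hc (Set.mem_biUnion (x := W P) ?_ hlP)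
      exact Finset.mem_erase.mpr ⟨hne, Finset.mem_image_of_mem W (hs.mem_toFinset.mpr hP)⟩
    intro i
    have : Pi.single i 1 ∈ W P := htop ▸ Submodule.mem_top
    have h2 : L (Pi.single i 1) ∈ P := this
    simpa [L] using h2

/-- There is a linear form such that everything that it multiplies into `I` is multiplied into `I`
by a power of the irrelevant ideal. -/
theorem exists_linear_pow_le (I : Ideal CoordRing) :
    ∃ l : CoordRing, l.IsHomogeneous 1 ∧ ∃ N, ∀ u, u * l ∈ I →
      ∀ v ∈ idealOfVars (Fin 3) ℂ ^ N, v * u ∈ I := by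
  obtain ⟨l, hl, hlP⟩ := exists_linear_notMem (associatedPrimes.finite CoordRing (CoordRing ⧸ I))
  refine ⟨l, hl, ?_⟩
  let K := LinearMap.ker (LinearMap.lsmul CoordRing (CoordRing ⧸ I) l)
  -- The minimal primes over the annihilator of K are associated primes of the quotient by I, and
  -- they contain l because l kills K; by the choice of l they contain all variables.
  have hrad : idealOfVars (Fin 3) ℂ ≤ (Module.annihilator CoordRing K).radical := by
    rw [idealOfVars, Ideal.span_le]
    rintro _ ⟨i, rfl⟩
    rw [← Ideal.sInf_minimalPrimes]
    refine Ideal.mem_sInf.mpr fun {P} hP => hlP P ?_ ?_ i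
    · exact associatedPrimes.subset_of_injective (f := K.subtype) K.injective_subtype
        (Module.associatedPrimes.minimalPrimes_annihilator_subset_associatedPrimes _ _ hP)
    · refine hP.1.2 (Module.mem_annihilator.mpr fun m => Subtype.ext ?_)
      exact m.2
  obtain ⟨N, hN⟩ := Ideal.exists_pow_le_of_le_radical_of_fg hrad (idealOfVars_fg _ _)
  have hsmul : ∀ a b, a • Ideal.Quotient.mk I b = Ideal.Quotient.mk I (a * b) := fun _ _ => rfl
  refine ⟨N, fun u hu v hv => ?_⟩
  have hu' : Ideal.Quotient.mk I u ∈ K := by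
    change l • Ideal.Quotient.mk I u = 0
    rw [hsmul, Ideal.Quotient.eq_zero_iff_mem, mul_comm]
    exact hu
  have h := congrArg Subtype.val (Module.mem_annihilator.mp (hN hv) ⟨_, hu'⟩)
  change v • Ideal.Quotient.mk I u = 0 at h
  rwa [hsmul, Ideal.Quotient.eq_zero_iff_mem] at h

/-- Multiplication by a suitable linear form is injective on the graded pieces of large degree of
the quotient by a homogeneous ideal. -/
theorem exists_linear_injective (I : Ideal CoordRing) :
    ∃ l : CoordRing, l.IsHomogeneous 1 ∧ ∃ N, ∀ n ≥ N, ∀ u : CoordRing, u.IsHomogeneous n →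
      u * l ∈ I → u ∈ I := by
  obtain ⟨l, hl, N, hN⟩ := exists_linear_pow_le I
  refine ⟨l, hl, ?_⟩
  -- T n is generated by the forms of degree at most n in the colon ideal (I : l). Once T is
  -- constant from D on, a form in (I : l) of degree at least D + N is a combination of generators
  -- of degree at most D with coefficients of degree at least N, and those products lie in I.
  let T : ℕ →o Ideal CoordRing :=
    { toFun n := Ideal.span {u | u * l ∈ I ∧ ∃ k ≤ n, u.IsHomogeneous k}
      monotone' m n h := Ideal.span_mono fun u hu =>
        ⟨hu.1, hu.2.imp fun k hk => ⟨hk.1.trans h, hk.2⟩⟩ }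
  obtain ⟨D, hD⟩ := monotone_stabilizes_iff_noetherian.mpr
    (inferInstance : IsNoetherian CoordRing CoordRing) T
  refine ⟨D + N, fun n hn u hu hul => ?_⟩
  have huT : u ∈ T D := by
    rw [hD n (by omega)]
    exact Ideal.subset_span ⟨hul, n, le_rfl, hu⟩
  obtain ⟨c, hc, hsum⟩ := Submodule.mem_span_set.mp huT
  rw [← homogeneousComponent_eq_self hu, ← hsum, Finsupp.sum, map_sum]
  refine Ideal.sum_mem _ fun k hk => ?_
  obtain ⟨hkl, e, he, hke⟩ := hc hk
  rw [smul_eq_mul, homogeneousComponent_mul_of_le hke (by omega)]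
  refine hN k hkl _ ((mem_pow_idealOfVars_iff' _ _).mpr fun s hs => ?_)
  exact (homogeneousComponent_isHomogeneous (n - e) (c k)).coeff_eq_zero (by omega)

theorem exists_eventually_const {c : ℕ → ℕ} {N B : ℕ} (hmono : ∀ n ≥ N, c n ≤ c (n + 1))
    (hB : ∀ n ≥ N, c n ≤ B) : ∃ t, ∀ᶠ n in Filter.atTop, c n = t := by
  have hmono' : Monotone fun k => c (N + k) := monotone_nat_of_le_succ fun k => hmono _ (by omega)
  have hbdd : BddAbove (Set.range fun k => c (N + k)) :=
    ⟨B, by rintro _ ⟨k, rfl⟩; exact hB _ (by omega)⟩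
  obtain ⟨k, hk⟩ := Nat.sSup_mem (Set.range_nonempty fun k => c (N + k)) hbdd
  refine ⟨c (N + k), Filter.eventually_atTop.mpr ⟨N + k, fun n hn => le_antisymm ?_ ?_⟩⟩
  · obtain ⟨j, rfl⟩ := Nat.exists_eq_add_of_le (show N ≤ n by omega)
    exact (le_csSup hbdd ⟨j, rfl⟩).trans_eq hk.symm
  · obtain ⟨j, rfl⟩ := Nat.exists_eq_add_of_le (show N ≤ n by omega)
    exact hmono' (by omega)

/-- The ideal generated by three forms of the same degree without common prime factors has constant
Hilbert polynomial. -/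
theorem exists_finrank_quotient_eq {F : Fin 3 → CoordRing} (hF : ∀ p, Prime p → ∃ i, ¬ p ∣ F i)
    {e : ℕ} (hhom : ∀ i, (F i).IsHomogeneous e) :
    ∃ t, ∀ᶠ n in Filter.atTop, Module.finrank ℂ
      (homogeneousSubmodule (Fin 3) ℂ n ⧸ gradedPart (Ideal.span (Set.range F)) n) = t := by
  obtain ⟨p, q, hp, hq, hp0, hpq, hpI, hqI⟩ := exists_isRelPrime hF hhom
  obtain ⟨l, hl, N, hN⟩ := exists_linear_injective (Ideal.span (Set.range F))
  -- Multiplication by l makes the Hilbert function of the quotient nondecreasing in large degrees,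
  -- and the Bézout bound e² makes it bounded.
  refine exists_eventually_const (N := N + e + e) (B := e ^ 2) (fun n hn => ?_) fun n hn => ?_
  · have hle : gradedPart (Ideal.span (Set.range F)) n ≤
        (gradedPart (Ideal.span (Set.range F)) (n + 1)).comap (mulHom hl n) :=
      fun u hu => Ideal.mul_mem_right l (Ideal.span (Set.range F)) hu
    refine LinearMap.finrank_le_finrank_of_injective
      (f := Submodule.mapQ _ _ (mulHom hl n) hle) ((injective_iff_map_eq_zero _).mpr fun u hu => ?_)
    obtain ⟨u, rfl⟩ := Submodule.Quotient.mk_surjective _ u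
    rw [Submodule.mapQ_apply, Submodule.Quotient.mk_eq_zero] at hu
    rw [Submodule.Quotient.mk_eq_zero]
    exact hN n (by omega) u u.2 hu
  · obtain ⟨k, rfl⟩ := Nat.exists_eq_add_of_le (show e + e ≤ n by omega)
    have := finrank_quotient_le hp hq hp0 hpq hpI hqI k
    rwa [show k + e + e = e + e + k by ring] at this

/-- The syzygies of degree `n` of three polynomials. -/
def syzygies (F : Fin 3 → CoordRing) (n : ℕ) : Submodule ℂ (Fin 3 → CoordRing) where
  carrier := {b | (∀ i, (b i).IsHomogeneous n) ∧ ∑ i, b i * F i = 0}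
  zero_mem' := ⟨fun i => isHomogeneous_zero _ _ _, by simp⟩
  add_mem' ha hb := ⟨fun i => (ha.1 i).add (hb.1 i), by
    simp only [Pi.add_apply, add_mul, Finset.sum_add_distrib, ha.2, hb.2, add_zero]⟩
  smul_mem' c b hb := ⟨fun i => (homogeneousSubmodule (Fin 3) ℂ n).smul_mem c (hb.1 i), by
    simp only [Pi.smul_apply, smul_mul_assoc, ← Finset.smul_sum, hb.2, smul_zero]⟩

/-- The map `(u₀, u₁, u₂) ↦ u₀ F₀ + u₁ F₁ + u₂ F₂` in a fixed degree. -/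
def combination {F : Fin 3 → CoordRing} {e : ℕ} (hhom : ∀ i, (F i).IsHomogeneous e) (n : ℕ) :
    (Fin 3 → homogeneousSubmodule (Fin 3) ℂ n) →ₗ[ℂ] homogeneousSubmodule (Fin 3) ℂ (n + e) :=
  ∑ i, mulHom (hhom i) n ∘ₗ LinearMap.proj i

theorem combination_apply {F : Fin 3 → CoordRing} {e : ℕ} (hhom : ∀ i, (F i).IsHomogeneous e)
    (n : ℕ) (u : Fin 3 → homogeneousSubmodule (Fin 3) ℂ n) :
    (combination hhom n u : CoordRing) = ∑ i, (u i : CoordRing) * F i := by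
  simp [combination, mulHom]

theorem range_combination {F : Fin 3 → CoordRing} {e : ℕ} (hhom : ∀ i, (F i).IsHomogeneous e)
    (n : ℕ) : LinearMap.range (combination hhom n) =
      gradedPart (Ideal.span (Set.range F)) (n + e) := by
  ext u
  rw [mem_gradedPart, Ideal.mem_span_range_iff_exists_fun]
  refine ⟨?_, fun ⟨c, hc⟩ => ?_⟩
  · rintro ⟨v, rfl⟩
    exact ⟨fun i => v i, (combination_apply hhom n v).symm⟩
  · refine ⟨fun i => ⟨homogeneousComponent n (c i), homogeneousComponent_isHomogeneous _ _⟩,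
      Subtype.ext ?_⟩
    rw [combination_apply, ← homogeneousComponent_eq_self u.2, ← hc, map_sum]
    refine Finset.sum_congr rfl fun i _ => ?_
    rw [homogeneousComponent_mul_of_le (hhom i) (Nat.le_add_left e n), Nat.add_sub_cancel]

theorem map_ker_combination {F : Fin 3 → CoordRing} {e : ℕ} (hhom : ∀ i, (F i).IsHomogeneous e)
    (n : ℕ) : (LinearMap.ker (combination hhom n)).map
      ((homogeneousSubmodule (Fin 3) ℂ n).subtype.compLeft (Fin 3)) = syzygies F n := by
  ext b
  constructor
  · rintro ⟨u, hu, rfl⟩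
    exact ⟨fun i => (u i).2, (combination_apply hhom n u).symm.trans (congrArg Subtype.val hu)⟩
  · intro hb
    exact ⟨fun i => ⟨b i, hb.1 i⟩, Subtype.ext ((combination_apply hhom n _).trans hb.2), rfl⟩

theorem injective_subtype_compLeft (n : ℕ) : Function.Injective
    ((homogeneousSubmodule (Fin 3) ℂ n).subtype.compLeft (Fin 3)) := fun _ _ h =>
  funext fun i => Subtype.ext (congrFun h i)

theorem syzygies_finite {F : Fin 3 → CoordRing} {e : ℕ} (hhom : ∀ i, (F i).IsHomogeneous e)
    (n : ℕ) : Module.Finite ℂ (syzygies F n) := by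
  rw [← map_ker_combination hhom n]
  exact Module.Finite.map _ _

/-- The Hilbert function of the module of syzygies. -/
theorem exists_finrank_syzygies {F : Fin 3 → CoordRing} (hF : ∀ p, Prime p → ∃ i, ¬ p ∣ F i)
    {e : ℕ} (hhom : ∀ i, (F i).IsHomogeneous e) :
    ∃ t, ∀ᶠ n in Filter.atTop,
      Module.finrank ℂ (syzygies F n) + (n + e + 2).choose 2 = 3 * (n + 2).choose 2 + t := by
  obtain ⟨t, ht⟩ := exists_finrank_quotient_eq hF hhom
  obtain ⟨N, hN⟩ := Filter.eventually_atTop.mp ht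
  refine ⟨t, Filter.eventually_atTop.mpr ⟨N, fun n hn => ?_⟩⟩
  have h1 := hN (n + e) (by omega)
  have h2 := LinearMap.finrank_range_add_finrank_ker (combination hhom n)
  have h3 := (gradedPart (Ideal.span (Set.range F)) (n + e)).finrank_quotient_add_finrank
  have h4 := (Submodule.equivMapOfInjective _ (injective_subtype_compLeft n)
    (LinearMap.ker (combination hhom n))).finrank_eq
  rw [map_ker_combination] at h4
  rw [h1] at h3
  rw [range_combination, Module.finrank_pi_fintype] at h2
  simp only [finrank_homogeneousSubmodule, Finset.sum_const, Finset.card_univ, Fintype.card_fin,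
    smul_eq_mul] at h2 h3
  have h5 : _ = Module.finrank ℂ (syzygies F n) := h4
  rw [h5] at h2
  omega

/-! ### Germs as rational functions -/

/-- The field of fractions of the homogeneous coordinate ring. -/
abbrev FracField : Type := FractionRing CoordRing

/-- The inclusion of the homogeneous coordinate ring into its field of fractions. -/
abbrev toFrac : CoordRing →+* FracField := algebraMap CoordRing FracField

theorem toFrac_injective : Function.Injective toFrac := IsFractionRing.injective CoordRing FracField

theorem toFrac_ne_zero {a : CoordRing} (h : a ≠ 0) : toFrac a ≠ 0 := fun h0 =>
  h (toFrac_injective (h0.trans (map_zero _).symm))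

theorem ne_zero_of_notMem {x : P2} {a : CoordRing} (h : a ∉ pointIdeal x) : a ≠ 0 := fun h0 =>
  h (h0 ▸ zero_mem _)

/-- The inclusion of the localization of the coordinate ring at a point into the field of
fractions. -/
def locToFrac (x : P2) : Localization (pointIdeal x).primeCompl →+* FracField :=
  IsLocalization.lift (M := (pointIdeal x).primeCompl) (g := toFrac) fun c =>
    isUnit_iff_ne_zero.mpr (toFrac_ne_zero (ne_zero_of_notMem c.2))

theorem locToFrac_mk (x : P2) (a : CoordRing) (c : (pointIdeal x).primeCompl) :
    locToFrac x (Localization.mk a c) = toFrac a / toFrac c := by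
  rw [Localization.mk_eq_mk', locToFrac, IsLocalization.lift_mk'_spec]
  rw [mul_div_cancel₀ _ (toFrac_ne_zero (ne_zero_of_notMem c.2))]

theorem locToFrac_injective (x : P2) : Function.Injective (locToFrac x) := by
  rw [injective_iff_map_eq_zero]
  intro z hz
  induction z using Localization.induction_on with
  | H y =>
    rw [locToFrac_mk, div_eq_zero_iff] at hz
    have h0 : y.1 = 0 := toFrac_injective ((hz.resolve_right
      (toFrac_ne_zero (ne_zero_of_notMem y.2.2))).trans (map_zero _).symm)
    rw [h0, Localization.mk_zero]

/-- A germ of a regular function as an element of the field of fractions of the homogeneous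
coordinate ring. -/
def germToFrac (x : P2) : LocalRing x →+* FracField :=
  (locToFrac x).comp (algebraMap (LocalRing x) (Localization (pointIdeal x).primeCompl))

theorem germToFrac_apply (x : P2) (s : LocalRing x) : germToFrac x s = locToFrac x s.val := rfl

theorem germToFrac_injective (x : P2) : Function.Injective (germToFrac x) := by
  intro a b h
  rw [germToFrac_apply, germToFrac_apply] at h
  exact HomogeneousLocalization.val_injective _ (locToFrac_injective x h)

instance (x : P2) : IsDomain (LocalRing x) := (germToFrac_injective x).isDomain

theorem germToFrac_mk (x : P2)
    (c : HomogeneousLocalization.NumDenSameDeg grading (pointIdeal x).primeCompl) :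
    germToFrac x (.mk c) = toFrac c.num / toFrac c.den := by
  rw [germToFrac_apply, HomogeneousLocalization.val_mk, locToFrac_mk]

theorem exists_germToFrac_eq {x : P2} (s : LocalRing x) :
    ∃ (n : ℕ) (a c : CoordRing), a.IsHomogeneous n ∧ c.IsHomogeneous n ∧ c ∉ pointIdeal x ∧
      germToFrac x s = toFrac a / toFrac c := by
  obtain ⟨y, rfl⟩ := HomogeneousLocalization.mk_surjective s
  exact ⟨y.deg, y.num, y.den, y.num.2, y.den.2, y.den_mem, germToFrac_mk x y⟩

theorem exists_germ {x : P2} {n : ℕ} {a c : CoordRing} (ha : a.IsHomogeneous n)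
    (hc : c.IsHomogeneous n) (hx : c ∉ pointIdeal x) :
    ∃ s, germToFrac x s = toFrac a / toFrac c :=
  ⟨.mk ⟨n, ⟨a, ha⟩, ⟨c, hc⟩, hx⟩, germToFrac_mk x _⟩

theorem germToFrac_algebraMap (x : P2) (c : ℂ) :
    germToFrac x (algebraMap ℂ (LocalRing x) c) = toFrac (C c) := by
  have : algebraMap ℂ (LocalRing x) c = .mk ⟨0, algebraMap ℂ (grading 0) c,
    ⟨1, SetLike.GradedOne.one_mem⟩, one_mem _⟩ := rfl
  rw [this, germToFrac_mk]
  simp only [map_one, div_one]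
  rfl

/-- The curve ideal is contracted from the full localization, so neither p nor c has to be
homogeneous. -/
theorem mem_curveIdeal {f : CoordRing} {x : P2} {s : LocalRing x} :
    s ∈ curveIdeal f x ↔ ∃ p c : CoordRing, c ∉ pointIdeal x ∧
      germToFrac x s = toFrac f * (toFrac p / toFrac c) := by
  rw [curveIdeal, Ideal.mem_comap, Ideal.map_span, Set.image_singleton, Ideal.mem_span_singleton]
  have hf : ∀ z : Localization (pointIdeal x).primeCompl,
      locToFrac x (algebraMap CoordRing _ f * z) = toFrac f * locToFrac x z := fun z => by
    rw [map_mul, locToFrac, IsLocalization.lift_eq]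
  constructor
  · rintro ⟨z, hz⟩
    induction z using Localization.induction_on with
    | H y =>
      refine ⟨y.1, y.2, y.2.2, ?_⟩
      change locToFrac x _ = _
      rw [hz, hf, locToFrac_mk]
  · rintro ⟨p, c, hc, h⟩
    refine ⟨Localization.mk p ⟨c, hc⟩, locToFrac_injective x ?_⟩
    rw [hf, locToFrac_mk]
    exact h

theorem pow_notMem {x : P2} {i : Fin 3} (h : x ∈ chart i) (n : ℕ) :
    (X i ^ n : CoordRing) ∉ pointIdeal x := fun h0 =>
  h (Ideal.IsPrime.mem_of_pow_mem inferInstance n h0)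

theorem mul_notMem {x : P2} {a b : CoordRing} (ha : a ∉ pointIdeal x) (hb : b ∉ pointIdeal x) :
    a * b ∉ pointIdeal x := fun h =>
  (Ideal.IsPrime.mem_or_mem inferInstance h).elim ha hb

/-- The germ of a regular function at a point. -/
def sectionAt {U : P2.Opens} (s : Γ(P2, U)) (x : P2) (hx : x ∈ U) : LocalRing x := s.1 ⟨x, hx⟩

theorem sectionAt_res {U V : P2.Opens} (h : V ≤ U) (s : Γ(P2, U)) (x : P2) (hx : x ∈ V) :
    sectionAt (P2.presheaf.map (homOfLE h).op s) x hx = sectionAt s x (h hx) := rfl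

theorem sectionAt_pow {U : P2.Opens} (s : Γ(P2, U)) (n : ℕ) (x : P2) (hx : x ∈ U) :
    sectionAt (s ^ n) x hx = sectionAt s x hx ^ n := rfl

theorem germToFrac_ratio {i : Fin 3} (j : Fin 3) {x : P2} (hx : x ∈ chart i) :
    germToFrac x (sectionAt (ratio i j) x hx) = toFrac (X j) / toFrac (X i) :=
  germToFrac_mk x _

/-! ### Regular functions -/

/-- The local-fraction condition on sections, transported to the fraction field: injectivity of
`germToFrac` lets germs be recognized by their values there. -/
theorem exists_section {U : P2.Opens} (g : ∀ x ∈ U, LocalRing x)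
    (h : ∀ x ∈ U, ∃ (V : P2.Opens) (_ : V ≤ U) (n : ℕ) (a b : CoordRing), x ∈ V ∧
      a.IsHomogeneous n ∧ b.IsHomogeneous n ∧ ∀ (y : P2) (_ : y ∈ V) (hU : y ∈ U),
        b ∉ pointIdeal y ∧ germToFrac y (g y hU) = toFrac a / toFrac b) :
    ∃ t : Γ(P2, U), ∀ x hx, sectionAt t x hx = g x hx := by
  refine ⟨⟨fun x => g x.1 x.2, fun x => ?_⟩, fun _ _ => rfl⟩
  obtain ⟨V, hV, n, a, b, hx, ha, hb, hab⟩ := h x.1 x.2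
  have hb' : ∀ y : V, b ∉ pointIdeal y.1 := fun y => (hab y.1 y.2 (hV y.2)).1
  have hg : ∀ y : V, g y.1 (hV y.2) = .mk ⟨n, ⟨a, ha⟩, ⟨b, hb⟩, hb' y⟩ := fun y =>
    germToFrac_injective y.1 (by rw [(hab y.1 y.2 (hV y.2)).2, germToFrac_mk])
  exact ⟨V, hx, homOfLE hV, n, ⟨a, ha⟩, ⟨b, hb⟩, hb', hg⟩

theorem exists_local_fraction {U : P2.Opens} (s : Γ(P2, U)) {x : P2} (hx : x ∈ U) :
    ∃ (V : P2.Opens) (_ : V ≤ U) (n : ℕ) (a b : CoordRing), x ∈ V ∧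
      a.IsHomogeneous n ∧ b.IsHomogeneous n ∧ ∀ (y : P2) (_ : y ∈ V) (hU : y ∈ U),
        b ∉ pointIdeal y ∧ germToFrac y (sectionAt s y hU) = toFrac a / toFrac b := by
  obtain ⟨V, hx, i, n, a, b, hb, hab⟩ := s.2 ⟨x, hx⟩
  refine ⟨V, i.le, n, a, b, hx, a.2, b.2, fun y hy hU => ⟨hb ⟨y, hy⟩, ?_⟩⟩
  have h : sectionAt s y hU = _ := hab ⟨y, hy⟩
  rw [h]
  exact germToFrac_mk y _

/-- Regular functions on a standard chart are fractions with a power of the coordinate as the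
denominator. -/
theorem exists_chart_fraction {i : Fin 3} (s : Γ(P2, chart i)) :
    ∃ (n : ℕ) (a : CoordRing), a.IsHomogeneous n ∧
      ∀ x hx, germToFrac x (sectionAt s x hx) = toFrac a / toFrac (X i) ^ n := by
  let e := Proj.basicOpenIsoAway grading (X i) (isHomogeneous_X ℂ i) one_pos
  obtain ⟨z, hz⟩ : ∃ z, e.hom z = s := ⟨e.inv s, by simp⟩
  obtain ⟨n, a, ha, hza⟩ :=
    HomogeneousLocalization.Away.mk_surjective grading (isHomogeneous_X ℂ i) z
  refine ⟨n, a, ?_, fun x hx => ?_⟩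
  · simpa using ha
  · have : sectionAt s x hx = HomogeneousLocalization.mk ⟨n • 1, ⟨a, ha⟩,
        ⟨X i ^ n, SetLike.pow_mem_graded n (isHomogeneous_X ℂ i)⟩, pow_notMem hx n⟩ := by
      rw [← hz, ← hza]
      rfl
    rw [this, germToFrac_mk, map_pow]

/-! ### Derivations of the field of fractions -/

/-- The ring homomorphism `a ↦ a + ε θ(a)` attached to a derivation. -/
def dualNumberHom (θ : Derivation ℂ CoordRing CoordRing) :
    CoordRing →+* TrivSqZeroExt FracField FracField where
  toFun a := .inl (toFrac a) + .inr (toFrac (θ a))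
  map_one' := by simp
  map_zero' := by simp
  map_add' a b := by simp only [map_add, TrivSqZeroExt.inl_add, TrivSqZeroExt.inr_add]; abel
  map_mul' a b := by
    ext
    · simp
    · simp only [map_mul, Derivation.leibniz, map_add, smul_eq_mul, TrivSqZeroExt.fst_add,
        TrivSqZeroExt.fst_inl, TrivSqZeroExt.fst_inr, TrivSqZeroExt.snd_add, TrivSqZeroExt.snd_inl,
        TrivSqZeroExt.snd_inr, TrivSqZeroExt.snd_mul, op_smul_eq_smul]
      ring

theorem fst_dualNumberHom (θ : Derivation ℂ CoordRing CoordRing) (a : CoordRing) :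
    (dualNumberHom θ a).fst = toFrac a := by simp [dualNumberHom]

theorem snd_dualNumberHom (θ : Derivation ℂ CoordRing CoordRing) (a : CoordRing) :
    (dualNumberHom θ a).snd = toFrac (θ a) := zero_add _

/-- The extension of `a ↦ a + ε θ(a)` to fractions. -/
def dualNumberLift (θ : Derivation ℂ CoordRing CoordRing) :
    FracField →+* TrivSqZeroExt FracField FracField :=
  IsLocalization.lift (M := nonZeroDivisors CoordRing) (g := dualNumberHom θ) fun c => by
    -- A dual number is invertible as soon as its first component is, so the universal property of
    -- the localization applies to a ↦ a + ε θ(a).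
    rw [TrivSqZeroExt.isUnit_iff_isUnit_fst, fst_dualNumberHom]
    exact isUnit_iff_ne_zero.mpr (toFrac_ne_zero (nonZeroDivisors.ne_zero c.2))

theorem dualNumberLift_toFrac (θ : Derivation ℂ CoordRing CoordRing) (a : CoordRing) :
    dualNumberLift θ (toFrac a) = dualNumberHom θ a := IsLocalization.lift_eq _ _

/-- With first component the identity, multiplicativity of the lift says exactly that its second
component obeys the Leibniz rule. -/
theorem fst_dualNumberLift (θ : Derivation ℂ CoordRing CoordRing) (z : FracField) :
    (dualNumberLift θ z).fst = z := by
  have h : ((TrivSqZeroExt.fstHom FracField FracField FracField).toRingHom.comp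
      (dualNumberLift θ)) = RingHom.id _ := by
    refine IsLocalization.ringHom_ext (nonZeroDivisors CoordRing) (RingHom.ext fun a => ?_)
    change (dualNumberLift θ (toFrac a)).fst = toFrac a
    rw [dualNumberLift_toFrac, fst_dualNumberHom]
  exact congrArg (fun φ => φ z) h

/-- The extension of a derivation of the coordinate ring to the field of fractions. -/
def fracDer (θ : Derivation ℂ CoordRing CoordRing) : FracField →+ FracField where
  toFun z := (dualNumberLift θ z).snd
  map_zero' := by simp
  map_add' a b := by simp

theorem fracDer_toFrac (θ : Derivation ℂ CoordRing CoordRing) (a : CoordRing) :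
    fracDer θ (toFrac a) = toFrac (θ a) := by
  change (dualNumberLift θ (toFrac a)).snd = _
  rw [dualNumberLift_toFrac, snd_dualNumberHom]

theorem fracDer_mul (θ : Derivation ℂ CoordRing CoordRing) (y z : FracField) :
    fracDer θ (y * z) = y * fracDer θ z + z * fracDer θ y := by
  change (dualNumberLift θ (y * z)).snd = _
  rw [map_mul, TrivSqZeroExt.snd_mul, fst_dualNumberLift, fst_dualNumberLift, op_smul_eq_smul]
  rfl

theorem fracDer_div (θ : Derivation ℂ CoordRing CoordRing) (a : CoordRing) {c : CoordRing}
    (hc : c ≠ 0) : fracDer θ (toFrac a / toFrac c) =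
      toFrac (θ a * c - a * θ c) / toFrac (c * c) := by
  have hc' := toFrac_ne_zero hc
  have h := fracDer_mul θ (toFrac a / toFrac c) (toFrac c)
  rw [div_mul_cancel₀ _ hc', fracDer_toFrac, fracDer_toFrac] at h
  simp only [map_sub, map_mul]
  field_simp at h ⊢
  linear_combination -h

/-- The derivation `∑ bᵢ ∂ᵢ` of the homogeneous coordinate ring. -/
def polyDer (b : Fin 3 → CoordRing) : Derivation ℂ CoordRing CoordRing := ∑ i, b i • pderiv i

theorem polyDer_apply (b : Fin 3 → CoordRing) (p : CoordRing) :
    polyDer b p = ∑ i, b i * pderiv i p := by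
  simp only [polyDer, Fin.sum_univ_three, Derivation.add_apply, Derivation.smul_apply, smul_eq_mul]

theorem polyDer_X (b : Fin 3 → CoordRing) (j : Fin 3) : polyDer b (X j) = b j := by
  rw [polyDer_apply, Finset.sum_eq_single j]
  · simp
  · intro i _ hij
    rw [pderiv_X_of_ne hij.symm, mul_zero]
  · simp

theorem isHomogeneous_polyDer {b : Fin 3 → CoordRing} {m n : ℕ}
    (hb : ∀ i, (b i).IsHomogeneous (m + 1)) {p : CoordRing} (hp : p.IsHomogeneous n) :
    (polyDer b p).IsHomogeneous (m + n) := by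
  rw [polyDer_apply]
  refine IsHomogeneous.sum _ _ _ fun i _ => ?_
  obtain _ | n := n
  · rw [totalDegree_eq_zero_iff_eq_C.mp ((totalDegree_zero_iff_isHomogeneous _).mpr hp), pderiv_C,
      mul_zero]
    exact isHomogeneous_zero _ _ _
  · have := (hb i).mul (hp.pderiv (i := i))
    rwa [show m + 1 + (n + 1 - 1) = m + (n + 1) by omega] at this

/-! ### Derivations of the local rings -/

/-- A derivation of the field of fractions that preserves a local ring, restricted to it. -/
theorem exists_derivation {x : P2} (δ : FracField →+ FracField)
    (hmul : ∀ y z, δ (y * z) = y * δ z + z * δ y) (hC : ∀ c : ℂ, δ (toFrac (C c)) = 0)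
    (h : ∀ s, ∃ r, germToFrac x r = δ (germToFrac x s)) :
    ∃ D : Derivation ℂ (LocalRing x) (LocalRing x),
      ∀ s, germToFrac x (D s) = δ (germToFrac x s) := by
  choose r hr using h
  refine ⟨Derivation.mk' { toFun := r, map_add' := fun s t => ?_, map_smul' := fun c s => ?_ }
    fun s t => ?_, hr⟩
  · apply germToFrac_injective
    simp only [map_add, hr]
  · apply germToFrac_injective
    simp only [Algebra.smul_def, map_mul, hr, hmul, germToFrac_algebraMap, hC, mul_zero, add_zero,
      RingHom.id_apply]
  · apply germToFrac_injective
    change germToFrac x (r (s * t)) = germToFrac x (s * r t + t * r s)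
    simp only [map_add, map_mul, hr, hmul]

/-- The derivation `Xᵢ⁻ᵐ ∑ bⱼ ∂ⱼ` of the field of fractions. -/
def chartDer (b : Fin 3 → CoordRing) (i : Fin 3) (m : ℕ) : FracField →+ FracField :=
  (AddMonoidHom.mulLeft (toFrac (X i ^ m))⁻¹).comp (fracDer (polyDer b))

theorem chartDer_apply (b : Fin 3 → CoordRing) (i : Fin 3) (m : ℕ) (z : FracField) :
    chartDer b i m z = (toFrac (X i ^ m))⁻¹ * fracDer (polyDer b) z := rfl

theorem chartDer_mul (b : Fin 3 → CoordRing) (i : Fin 3) (m : ℕ) (y z : FracField) :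
    chartDer b i m (y * z) = y * chartDer b i m z + z * chartDer b i m y := by
  simp only [chartDer_apply, fracDer_mul]; ring

theorem chartDer_C (b : Fin 3 → CoordRing) (i : Fin 3) (m : ℕ) (c : ℂ) :
    chartDer b i m (toFrac (C c)) = 0 := by
  rw [chartDer_apply, fracDer_toFrac, derivation_C, map_zero, mul_zero]

theorem chartDer_div (b : Fin 3 → CoordRing) (i : Fin 3) (m : ℕ) (a : CoordRing) {c : CoordRing}
    (hc : c ≠ 0) : chartDer b i m (toFrac a / toFrac c) =
      toFrac (polyDer b a * c - a * polyDer b c) / toFrac (X i ^ m * (c * c)) := by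
  rw [chartDer_apply, fracDer_div _ _ hc, map_mul toFrac (X i ^ m)]
  field_simp

theorem isHomogeneous_chartDer_num {b : Fin 3 → CoordRing} {m n : ℕ}
    (hb : ∀ i, (b i).IsHomogeneous (m + 1)) {a c : CoordRing} (ha : a.IsHomogeneous n)
    (hc : c.IsHomogeneous n) :
    (polyDer b a * c - a * polyDer b c).IsHomogeneous (m + (n + n)) := by
  have h1 := (isHomogeneous_polyDer hb ha).mul hc
  have h2 := ha.mul (isHomogeneous_polyDer hb hc)
  rw [show m + n + n = m + (n + n) by ring] at h1
  rw [show n + (m + n) = m + (n + n) by ring] at h2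
  exact h1.sub h2

theorem isHomogeneous_chartDer_den (i : Fin 3) (m : ℕ) {n : ℕ} {c : CoordRing}
    (hc : c.IsHomogeneous n) : (X i ^ m * (c * c)).IsHomogeneous (m + (n + n)) :=
  (isHomogeneous_X_pow i m).mul (hc.mul hc)

/-- The quotient rule turns a / c into (θ(a) c - a θ(c)) / (Xᵢᵐ c²), where θ = ∑ bⱼ∂ⱼ raises degrees
by m. Numerator and denominator both have degree m + 2n, and the denominator does not vanish at x.
-/
theorem exists_chartDer_germ {b : Fin 3 → CoordRing} {m : ℕ}
    (hb : ∀ i, (b i).IsHomogeneous (m + 1)) {i : Fin 3} {x : P2} (hx : x ∈ chart i)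
    (s : LocalRing x) : ∃ r, germToFrac x r = chartDer b i m (germToFrac x s) := by
  obtain ⟨n, a, c, ha, hc, hcx, h⟩ := exists_germToFrac_eq s
  rw [h, chartDer_div _ _ _ _ (ne_zero_of_notMem hcx)]
  exact exists_germ (isHomogeneous_chartDer_num hb ha hc) (isHomogeneous_chartDer_den i m hc)
    (mul_notMem (pow_notMem hx m) (mul_notMem hcx hcx))

/-- The derivation `Xᵢ⁻ᵐ ∑ bⱼ ∂ⱼ` of the local ring at a point with `Xᵢ ≠ 0`. -/
def germDer {b : Fin 3 → CoordRing} {m : ℕ} (hb : ∀ i, (b i).IsHomogeneous (m + 1)) {i : Fin 3}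
    {x : P2} (hx : x ∈ chart i) : Derivation ℂ (LocalRing x) (LocalRing x) :=
  (exists_derivation (chartDer b i m) (chartDer_mul b i m) (chartDer_C b i m)
    (exists_chartDer_germ hb hx)).choose

theorem germToFrac_germDer {b : Fin 3 → CoordRing} {m : ℕ}
    (hb : ∀ i, (b i).IsHomogeneous (m + 1)) {i : Fin 3} {x : P2} (hx : x ∈ chart i)
    (s : LocalRing x) : germToFrac x (germDer hb hx s) = chartDer b i m (germToFrac x s) :=
  (exists_derivation (chartDer b i m) (chartDer_mul b i m) (chartDer_C b i m)
    (exists_chartDer_germ hb hx)).choose_spec s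

theorem aeval_div_X {n : ℕ} {a : CoordRing} (ha : a.IsHomogeneous n) (i : Fin 3) :
    eval₂ (toFrac.comp C) (fun j => toFrac (X j) / toFrac (X i)) a =
      toFrac a / toFrac (X i) ^ n := by
  have hX : toFrac (X i) ≠ 0 := toFrac_ne_zero (X_ne_zero i)
  have h1 : eval₂ (toFrac.comp C) (fun j => toFrac (X j)) a = toFrac a :=
    (eval₂_comp_left toFrac C X a).symm.trans (by rw [eval₂_eta])
  rw [← h1, eval₂_eq, eval₂_eq, Finset.sum_div]
  refine Finset.sum_congr rfl fun s hs => ?_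
  have hdeg : ∑ j, s j = n := by
    rw [← Finsupp.degree_eq_sum]
    by_contra hne
    exact (mem_support_iff.mp hs) (ha.coeff_eq_zero hne)
  rw [mul_div_assoc]
  congr 1
  rw [Finset.prod_subset (Finset.subset_univ _) (by
      intro j _ hj; simp [Finsupp.notMem_support_iff.mp hj]),
    Finset.prod_subset (s₁ := s.support) (Finset.subset_univ _) (by
      intro j _ hj; simp [Finsupp.notMem_support_iff.mp hj]), ← hdeg,
    ← Finset.prod_pow_eq_pow_sum, ← Finset.prod_div_distrib]
  simp only [div_pow]

/-- A derivation of the local ring at a point is determined by its values on the ratios of the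
coordinates. -/
theorem derivation_eq_of_ratio {i : Fin 3} {x : P2} (hx : x ∈ chart i)
    {D E : Derivation ℂ (LocalRing x) (LocalRing x)}
    (h : ∀ j, D (sectionAt (ratio i j) x hx) = E (sectionAt (ratio i j) x hx)) : D = E := by
  let φ : CoordRing →ₐ[ℂ] LocalRing x := aeval fun j => sectionAt (ratio i j) x hx
  have hφ : ∀ (n : ℕ) (a : CoordRing), a.IsHomogeneous n →
      germToFrac x (φ a) = toFrac a / toFrac (X i) ^ n := fun n a ha => by
    rw [← aeval_div_X ha, aeval_def, eval₂_comp_left]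
    congr 1
    · ext c
      exact germToFrac_algebraMap x c
    · ext j
      exact germToFrac_ratio j hx
  have hDE : ∀ a, D (φ a) = E (φ a) := fun a => by
    induction a using MvPolynomial.induction_on with
    | C c => 
      have : φ (C c) = algebraMap ℂ _ c := φ.commutes c
      rw [this, Derivation.map_algebraMap, Derivation.map_algebraMap]
    | add p q hp hq => simp only [map_add, hp, hq]
    | mul_X p j hp =>
      have : φ (X j) = sectionAt (ratio i j) x hx := aeval_X _ j
      simp only [map_mul, Derivation.leibniz, hp, this, h]
  refine Derivation.ext fun s => ?_
  obtain ⟨n, a, c, ha, hc, hcx, hs⟩ := exists_germToFrac_eq s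
  have hX : toFrac (X i) ≠ 0 := toFrac_ne_zero (X_ne_zero i)
  have hc0 := toFrac_ne_zero (ne_zero_of_notMem hcx)
  -- Every germ is a quotient of dehomogenized forms, on which D and E agree; the Leibniz rule for s
  -- * φ c then determines the value at s.
  have hsφ : s * φ c = φ a := by
    apply germToFrac_injective
    rw [map_mul, hs, hφ n c hc, hφ n a ha]
    field_simp
  have hφc : φ c ≠ 0 := fun h0 => by
    have := hφ n c hc
    rw [h0, map_zero, eq_comm, div_eq_zero_iff] at this
    exact this.elim hc0 (pow_ne_zero n hX)
  have h1 : D (s * φ c) = E (s * φ c) := by rw [hsφ, hDE]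
  rw [Derivation.leibniz, Derivation.leibniz, hDE] at h1
  simp only [smul_eq_mul] at h1
  exact mul_left_cancel₀ hφc (add_left_cancel h1)

/-! ### Sections of the sheaf of logarithmic vector fields -/

/-- The derivation of the local ring at `x` given by a section of the sheaf of logarithmic vector
fields. -/
def fieldAt {f : CoordRing} {U : P2.Opens} (D : Γ(logTangentSheaf f, U)) (x : P2) (hx : x ∈ U) :
    Derivation ℂ (LocalRing x) (LocalRing x) :=
  (show logFields f U from D).1 ⟨x, hx⟩

theorem fieldAt_ext {f : CoordRing} {U : P2.Opens} {D E : Γ(logTangentSheaf f, U)}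
    (h : ∀ x hx, fieldAt D x hx = fieldAt E x hx) : D = E :=
  Subtype.ext (funext fun x => h x.1 x.2 :
    (show logFields f U from D).1 = (show logFields f U from E).1)

theorem fieldAt_isLogField {f : CoordRing} {U : P2.Opens} (D : Γ(logTangentSheaf f, U)) :
    IsLogField f U (fun x => fieldAt D x.1 x.2) := (show logFields f U from D).2

/-- The syzygies of degree `n` of the partial derivatives of `f`. -/
abbrev syz (f : CoordRing) (n : ℕ) : Submodule ℂ (Fin 3 → CoordRing) :=
  syzygies (fun i => pderiv i f) n

theorem exists_section_chartDer {b : Fin 3 → CoordRing} {m : ℕ}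
    (hb : ∀ i, (b i).IsHomogeneous (m + 1)) {i : Fin 3} {V : P2.Opens} (hV : V ≤ chart i)
    (s : Γ(P2, V)) :
    ∃ t : Γ(P2, V), ∀ x hx, sectionAt t x hx = germDer hb (hV hx) (sectionAt s x hx) := by
  refine exists_section _ fun x hx => ?_
  obtain ⟨W, hW, n, a, c, hx, ha, hc, h⟩ := exists_local_fraction s hx
  refine ⟨W, hW, _, _, _, hx, isHomogeneous_chartDer_num hb ha hc,
    isHomogeneous_chartDer_den i m hc, fun y hy hyV => ?_⟩
  obtain ⟨hcy, hs⟩ := h y hy hyV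
  refine ⟨mul_notMem (pow_notMem (hV hyV) m) (mul_notMem hcy hcy), ?_⟩
  rw [germToFrac_germDer, hs, chartDer_div _ _ _ _ (ne_zero_of_notMem hcy)]

/-- A syzygy gives a derivation that kills f, so it sends f · (p / c) to f times the derivative of p
/ c. -/
theorem germDer_mem_curveIdeal {f : CoordRing} {b : Fin 3 → CoordRing} {m : ℕ}
    (hb : b ∈ syz f (m + 1)) {i : Fin 3} {x : P2} (hx : x ∈ chart i) {s : LocalRing x}
    (hs : s ∈ curveIdeal f x) : germDer hb.1 hx s ∈ curveIdeal f x := by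
  obtain ⟨p, c, hc, h⟩ := mem_curveIdeal.mp hs
  refine mem_curveIdeal.mpr ⟨polyDer b p * c - p * polyDer b c, _,
    mul_notMem (pow_notMem hx m) (mul_notMem hc hc), ?_⟩
  have h0 : chartDer b i m (toFrac f) = 0 := by
    rw [chartDer_apply, fracDer_toFrac, polyDer_apply, hb.2, map_zero, mul_zero]
  rw [germToFrac_germDer, h, chartDer_mul, h0, mul_zero, add_zero,
    chartDer_div _ _ _ _ (ne_zero_of_notMem hc)]

/-- The logarithmic vector field `Xᵢ⁻ᵐ ∑ bⱼ ∂ⱼ` on the chart `Xᵢ ≠ 0` attached to a syzygy `b` of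
degree `m + 1`. -/
def chartField {f : CoordRing} {m : ℕ} {b : Fin 3 → CoordRing} (hb : b ∈ syz f (m + 1))
    (i : Fin 3) : Γ(logTangentSheaf f, chart i) :=
  show logFields f (chart i) from ⟨fun x => germDer hb.1 x.2, fun _ hV s =>
    (exists_section_chartDer hb.1 hV s).imp fun _ h x => h x.1 x.2,
    fun x _ hs => germDer_mem_curveIdeal hb x.2 hs⟩

/-- The action of a vector field on germs, with values in the field of fractions. -/
def actAt {f : CoordRing} {U : P2.Opens} (D : Γ(logTangentSheaf f, U)) (x : P2) (hx : x ∈ U)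
    (s : LocalRing x) : FracField := germToFrac x (fieldAt D x hx s)

theorem actAt_chartField {f : CoordRing} {m : ℕ} {b : Fin 3 → CoordRing}
    (hb : b ∈ syz f (m + 1)) {i : Fin 3} {x : P2} (hx : x ∈ chart i) (s : LocalRing x) :
    actAt (chartField hb i) x hx s = chartDer b i m (germToFrac x s) :=
  germToFrac_germDer hb.1 hx s

theorem section_eq_iff {f : CoordRing} {U : P2.Opens} {D E : Γ(logTangentSheaf f, U)} :
    D = E ↔ ∀ (x : P2) (hx : x ∈ U) (s : LocalRing x), actAt D x hx s = actAt E x hx s :=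
  ⟨fun h _ _ _ => by rw [h], fun h => fieldAt_ext fun x hx => Derivation.ext fun s =>
    germToFrac_injective _ (h x hx s)⟩

theorem actAt_add {f : CoordRing} {U : P2.Opens} (D E : Γ(logTangentSheaf f, U)) (x : P2)
    (hx : x ∈ U) (s : LocalRing x) : actAt (D + E) x hx s = actAt D x hx s + actAt E x hx s :=
  map_add (germToFrac x) _ _

theorem actAt_smul {f : CoordRing} {U : P2.Opens} (r : Γ(P2, U))
    (D : Γ(logTangentSheaf f, U)) (x : P2) (hx : x ∈ U) (s : LocalRing x) :
    actAt (r • D) x hx s = germToFrac x (sectionAt r x hx) * actAt D x hx s :=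
  map_mul (germToFrac x) _ _

theorem actAt_complex_smul {f : CoordRing} {U : P2.Opens} (c : ℂ)
    (D : Γ(logTangentSheaf f, U)) (x : P2) (hx : x ∈ U) (s : LocalRing x) :
    actAt (c • D) x hx s = toFrac (C c) * actAt D x hx s := by
  rw [← germToFrac_algebraMap x c]
  exact map_mul (germToFrac x) _ _

theorem actAt_res {f : CoordRing} {U V : P2.Opens} (h : V ≤ U) (D : Γ(logTangentSheaf f, U))
    (x : P2) (hx : x ∈ V) (s : LocalRing x) :
    actAt (res (logTangentSheaf f) h D) x hx s = actAt D x (h hx) s := rfl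

theorem mem_twistedSections_iff {f : CoordRing} {m : ℕ} (F : Subsheaf (logTangentSheaf f))
    (s : ∀ i, Γ(logTangentSheaf f, chart i)) :
    s ∈ F.twistedSections m ↔ (∀ i, s i ∈ F.sections (chart i)) ∧
      ∀ i j (x : P2) (hi : x ∈ chart i) (hj : x ∈ chart j) (t : LocalRing x),
        actAt (s i) x hi t = (toFrac (X j) / toFrac (X i)) ^ m * actAt (s j) x hj t := by
  refine and_congr_right fun _ => forall_congr' fun i => forall_congr' fun j => ?_
  rw [section_eq_iff]
  have key : ∀ (x : P2) (h : x ∈ chart i ⊓ chart j) (t : LocalRing x),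
      actAt (P2.presheaf.map
        (homOfLE (inf_le_left : chart i ⊓ chart j ≤ chart i)).op (ratio i j ^ m) •
          res (logTangentSheaf f) (inf_le_right : chart i ⊓ chart j ≤ chart j) (s j)) x h t =
        (toFrac (X j) / toFrac (X i)) ^ m * actAt (s j) x h.2 t := by
    intro x h t
    rw [actAt_smul, actAt_res, sectionAt_res, sectionAt_pow, map_pow, germToFrac_ratio]
  constructor
  · intro h x hi hj t
    exact (h x ⟨hi, hj⟩ t).trans (key x ⟨hi, hj⟩ t)
  · intro h x hx t
    exact (h x hx.1 hx.2 t).trans (key x hx t).symm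

theorem toFrac_X_ne_zero (i : Fin 3) : toFrac (X i) ≠ 0 := toFrac_ne_zero (X_ne_zero i)

/-- The fields Xᵢ⁻ᵐ ∑ bⱼ∂ⱼ always glue, because Xᵢ⁻ᵐ = (Xⱼ / Xᵢ)ᵐ Xⱼ⁻ᵐ; only membership in F is a
condition. -/
theorem chartField_mem_twistedSections {f : CoordRing} {m : ℕ} {b : Fin 3 → CoordRing}
    (hb : b ∈ syz f (m + 1)) (F : Subsheaf (logTangentSheaf f)) :
    chartField hb ∈ F.twistedSections m ↔ ∀ i, chartField hb i ∈ F.sections (chart i) := by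
  rw [mem_twistedSections_iff]
  refine and_iff_left fun i j x hi hj t => ?_
  rw [actAt_chartField, actAt_chartField, chartDer_apply, chartDer_apply, map_pow, map_pow, div_pow]
  have h1 := pow_ne_zero m (toFrac_X_ne_zero i)
  have h2 := pow_ne_zero m (toFrac_X_ne_zero j)
  field_simp

theorem polyDer_add (a b : Fin 3 → CoordRing) : polyDer (a + b) = polyDer a + polyDer b := by
  ext i; simp [polyDer_X]

theorem polyDer_mul (h : CoordRing) (b : Fin 3 → CoordRing) :
    polyDer (fun i => h * b i) = h • polyDer b := by
  ext i; simp [polyDer_X]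

theorem fracDer_eq_of {θ₁ θ₂ : Derivation ℂ CoordRing CoordRing} {k : FracField}
    (h : ∀ a, toFrac (θ₁ a) = k * toFrac (θ₂ a)) (z : FracField) :
    fracDer θ₁ z = k * fracDer θ₂ z := by
  obtain ⟨a, c, hc, rfl⟩ := IsFractionRing.div_surjective (A := CoordRing) z
  have hc0 := nonZeroDivisors.ne_zero hc
  have hc1 := toFrac_ne_zero hc0
  change fracDer θ₁ (toFrac a / toFrac c) = k * fracDer θ₂ (toFrac a / toFrac c)
  rw [fracDer_div _ _ hc0, fracDer_div _ _ hc0]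
  simp only [map_sub, map_mul, h]
  ring

theorem fracDer_add_left (θ₁ θ₂ : Derivation ℂ CoordRing CoordRing) (z : FracField) :
    fracDer (θ₁ + θ₂) z = fracDer θ₁ z + fracDer θ₂ z := by
  obtain ⟨a, c, hc, rfl⟩ := IsFractionRing.div_surjective (A := CoordRing) z
  have hc0 := nonZeroDivisors.ne_zero hc
  change fracDer _ (toFrac a / toFrac c) = fracDer _ (toFrac a / toFrac c) +
    fracDer _ (toFrac a / toFrac c)
  simp only [fracDer_div _ _ hc0, Derivation.add_apply, map_sub, map_mul, map_add]
  ring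

theorem chartDer_smul (h : CoordRing) (b : Fin 3 → CoordRing) (i : Fin 3) (m : ℕ)
    (z : FracField) : chartDer (fun i => h * b i) i m z = toFrac h * chartDer b i m z := by
  rw [chartDer_apply, chartDer_apply, polyDer_mul,
    fracDer_eq_of (k := toFrac h) (θ₂ := polyDer b) fun a => map_mul _ _ _]
  ring

/-- The vector fields attached to syzygies of degree `m + 1`. -/
def chartFields (f : CoordRing) (m : ℕ) :
    syz f (m + 1) →ₗ[ℂ] ∀ i, Γ(logTangentSheaf f, chart i) where
  toFun b := chartField b.2
  map_add' a b := funext fun i => section_eq_iff.mpr fun x hx s => by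
    rw [Pi.add_apply, actAt_add]
    simp only [actAt_chartField]
    rw [chartDer_apply, chartDer_apply, chartDer_apply, ← mul_add, ← fracDer_add_left,
      ← polyDer_add]
    rfl
  map_smul' c b := funext fun i => section_eq_iff.mpr fun x hx s => by
    have hcb : ((c • b : syz f (m + 1)) : Fin 3 → CoordRing) =
      fun j => C c * (b : Fin 3 → CoordRing) j := funext fun j => smul_eq_C_mul _ _
    rw [Pi.smul_apply, actAt_complex_smul, actAt_chartField, RingHom.id_apply, actAt_chartField,
      ← chartDer_smul, hcb]

/-! ### Points of the plane -/

/-- A prime over I that avoids X i has a prime homogeneous core. The core still contains I because I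
is homogeneous, and it is relevant because it avoids X i. -/
theorem exists_point {I : Ideal CoordRing} (hI : I.IsHomogeneous grading) {i : Fin 3}
    (h : X i ∉ I.radical) : ∃ x : P2, I ≤ pointIdeal x ∧ x ∈ chart i := by
  rw [Ideal.radical_eq_sInf, Ideal.mem_sInf] at h
  push Not at h
  obtain ⟨P, ⟨hIP, hP⟩, hiP⟩ := h
  have hle : (P.homogeneousCore grading).toIdeal ≤ P := Ideal.toIdeal_homogeneousCore_le grading P
  let x : P2 := ⟨P.homogeneousCore grading, hP.homogeneousCore, fun hirr => hiP (hle (hirr (by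
    rw [HomogeneousIdeal.mem_irrelevant_iff, GradedRing.proj_apply,
      DirectSum.decompose_of_mem_ne grading (isHomogeneous_X ℂ i) one_ne_zero])))⟩
  refine ⟨x, ?_, fun hx => hiP (hle hx)⟩
  have := Ideal.homogeneousCore_mono grading hIP
  rw [← hI.toIdeal_homogeneousCore_eq_self]
  exact this

theorem exists_mem_chart (x : P2) : ∃ i, x ∈ chart i := by
  by_contra! h
  have hX : ∀ i, (X i : CoordRing) ∈ pointIdeal x := fun i => not_not.mp (h i)
  refine x.not_irrelevant_le fun p hp => ?_
  rw [HomogeneousIdeal.mem_irrelevant_iff, GradedRing.proj_apply,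
    decompose_eq_homogeneousComponent] at hp
  have hle : idealOfVars (Fin 3) ℂ ^ 1 ≤ pointIdeal x := by
    rw [pow_one, idealOfVars, Ideal.span_le]
    rintro _ ⟨i, rfl⟩
    exact hX i
  refine hle ((mem_pow_idealOfVars_iff' 1 p).mpr fun s hs => ?_)
  have := congrArg (coeff s) hp
  rwa [coeff_homogeneousComponent, if_pos (by omega), coeff_zero] at this

/-- There is a point that lies on all charts. -/
theorem exists_generic_point : ∃ x : P2, ∀ i, x ∈ chart i := by
  have hbot : ∀ i, (X i : CoordRing) ∉ (⊥ : HomogeneousIdeal grading) := fun i h =>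
    X_ne_zero i ((Ideal.mem_bot).mp h)
  refine ⟨⟨⊥, ?_, fun hirr => hbot 0 (hirr ?_)⟩, hbot⟩
  · exact Ideal.isPrime_bot
  · rw [HomogeneousIdeal.mem_irrelevant_iff, GradedRing.proj_apply,
      DirectSum.decompose_of_mem_ne grading (isHomogeneous_X ℂ 0) one_ne_zero]

/-- Divisibility by a form may be checked locally. -/
theorem dvd_of_local {f w : CoordRing} {d n : ℕ} (hf : f.IsHomogeneous d) (hw : w.IsHomogeneous n)
    (hf0 : f ≠ 0) (h : ∀ x : P2, ∃ c ∉ pointIdeal x, f ∣ c * w) : f ∣ w := by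
  -- I is the colon ideal (f : w). It is homogeneous and by hypothesis lies in no point ideal, so it
  -- contains powers of all variables; these have no common prime factor.
  let I : Ideal CoordRing := Submodule.comap (LinearMap.mulRight CoordRing w) (Ideal.span {f})
  have hI : ∀ c, c ∈ I ↔ f ∣ c * w := fun c => Ideal.mem_span_singleton
  have hIh : I.IsHomogeneous grading := fun k c hc => by
    obtain ⟨q, hq⟩ := (hI c).mp hc
    rw [decompose_eq_homogeneousComponent, hI, ← Nat.add_sub_cancel k n,
      ← homogeneousComponent_mul_of_le hw (Nat.le_add_left n k), hq, mul_comm f]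
    rcases le_or_gt d (k + n) with hle | hlt
    · rw [homogeneousComponent_mul_of_le hf hle]
      exact dvd_mul_left _ _
    · rw [homogeneousComponent_mul_of_lt hf hlt]
      exact dvd_zero _
  have hX : ∀ i, X i ∈ I.radical := fun i => by
    by_contra hi
    obtain ⟨x, hx, -⟩ := exists_point hIh hi
    obtain ⟨c, hc, hcw⟩ := h x
    exact hc (hx ((hI c).mpr hcw))
  choose n hn using hX
  refine dvd_of_forall_dvd_mul (F := fun i : Fin 3 => (X i : CoordRing) ^ n i) (fun p hp => ?_) hf0
    fun j => ?_
  · by_contra! hall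
    exact hp.not_isUnit (isRelPrime_X_pow (i := 0) (j := 1) (by decide) _ _ (hall 0) (hall 1))
  · rw [mul_comm]
    exact (hI _).mp (hn j)

/-! ### Twisted global sections are syzygies -/

theorem chartDer_ratio (b : Fin 3 → CoordRing) (i j : Fin 3) (m : ℕ) :
    chartDer b i m (toFrac (X j) / toFrac (X i)) =
      toFrac (b j * X i - b i * X j) / toFrac (X i) ^ (m + 2) := by
  rw [chartDer_div _ _ _ _ (X_ne_zero i), polyDer_X, polyDer_X, ← map_pow, mul_comm (X j)]
  congr 2
  ring

/-- Koszul exactness for X₀, X₁, X₂. Applied to Q i j = X i ^ (m + 2) · s i (X j / X i), it lifts a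
twisted vector field to forms, the surjectivity on sections in the Euler sequence. -/
theorem exists_form_of_cocycle {m : ℕ} {Q : Fin 3 → Fin 3 → CoordRing}
    (hQ : ∀ i j, (Q i j).IsHomogeneous (m + 2)) (h0 : ∀ i, Q i i = 0)
    (hanti : ∀ i j, Q i j = -Q j i)
    (h : Q 1 2 * X 0 + Q 2 0 * X 1 + Q 0 1 * X 2 = 0) :
    ∃ b : Fin 3 → CoordRing, (∀ i, (b i).IsHomogeneous (m + 1)) ∧
      ∀ i j, Q i j = b j * X i - b i * X j := by
  obtain ⟨a₀, a₁, a₂, h12, h20, h01⟩ := exists_koszul_X_pow 1 (by simpa only [pow_one] using h)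
  let a : Fin 3 → CoordRing := ![-a₀, -a₁, -a₂]
  have key : ∀ i j, Q i j = a j * X i - a i * X j := by
    refine forall_fin_three_of_symm (fun i => ?_) (fun i j hij => ?_) ?_ ?_ ?_
    · rw [h0, sub_self]
    · rw [hanti, hij]; ring
    · simp only [a, Matrix.cons_val, h01]; ring
    · simp only [a, Matrix.cons_val, h12]; ring
    · simp only [a, Matrix.cons_val, h20]; ring
  -- The Koszul witnesses need not be homogeneous; their components of degree m + 1 solve the same
  -- equations.
  refine ⟨fun i => homogeneousComponent (m + 1) (a i),
    fun i => homogeneousComponent_isHomogeneous _ _, fun i j => ?_⟩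
  rw [← homogeneousComponent_eq_self (hQ i j), key, map_sub,
    homogeneousComponent_mul_of_le (isHomogeneous_X ℂ i) (by omega),
    homogeneousComponent_mul_of_le (isHomogeneous_X ℂ j) (by omega)]
  rfl

/-- The value of a vector field on a ratio of coordinates is a fraction, the same at all points. -/
theorem exists_actAt_ratio {f : CoordRing} {i : Fin 3} (D : Γ(logTangentSheaf f, chart i))
    (j : Fin 3) : ∃ (n : ℕ) (u : CoordRing), u.IsHomogeneous n ∧ ∀ x hx,
      actAt D x hx (sectionAt (ratio i j) x hx) = toFrac u / toFrac (X i) ^ n := by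
  obtain ⟨t, ht⟩ := (fieldAt_isLogField D).regular (chart i) le_rfl (ratio i j)
  obtain ⟨n, u, hu, h⟩ := exists_chart_fraction t
  refine ⟨n, u, hu, fun x hx => ?_⟩
  rw [← h x hx]
  exact congrArg (germToFrac x) (ht ⟨x, hx⟩).symm

theorem actAt_mul {f : CoordRing} {U : P2.Opens} (D : Γ(logTangentSheaf f, U)) (x : P2)
    (hx : x ∈ U) (s t : LocalRing x) :
    actAt D x hx (s * t) = germToFrac x s * actAt D x hx t + germToFrac x t * actAt D x hx s := by
  simp only [actAt, Derivation.leibniz, smul_eq_mul, map_add, map_mul]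

theorem actAt_one {f : CoordRing} {U : P2.Opens} (D : Γ(logTangentSheaf f, U)) (x : P2)
    (hx : x ∈ U) : actAt D x hx 1 = 0 := by
  simp only [actAt, Derivation.map_one_eq_zero, map_zero]

/-- The values of the fields on coordinate ratios, cleared of the expected denominator X i ^ (m +
2), form an antisymmetric cocycle of polynomials. Its Koszul primitive is b. -/
theorem exists_form_of_twistedSections {f : CoordRing} {m : ℕ}
    {s : ∀ i, Γ(logTangentSheaf f, chart i)}
    (hs : s ∈ (Subsheaf.whole (logTangentSheaf f)).twistedSections m) :
    ∃ b : Fin 3 → CoordRing, (∀ i, (b i).IsHomogeneous (m + 1)) ∧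
      ∀ i j x hx, actAt (s i) x hx (sectionAt (ratio i j) x hx) =
        chartDer b i m (toFrac (X j) / toFrac (X i)) := by
  have hglue := ((mem_twistedSections_iff _ s).mp hs).2
  choose n u hu hact using fun i j => exists_actAt_ratio (s i) j
  obtain ⟨η, hη⟩ := exists_generic_point
  have hX := toFrac_X_ne_zero
  let T : Fin 3 → Fin 3 → FracField := fun i j =>
    toFrac (X i) ^ (m + 2) * (toFrac (u i j) / toFrac (X i) ^ n i j)
  have hT : ∀ i j, T i j = toFrac (X i) ^ (m + 2) *
      actAt (s i) η (hη i) (sectionAt (ratio i j) η (hη i)) := fun i j => by rw [hact]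
  have hT0 : ∀ i, T i i = 0 := fun i => by
    have : sectionAt (ratio i i) η (hη i) = 1 := germToFrac_injective η (by
      rw [germToFrac_ratio, map_one, div_self (hX i)])
    rw [hT, this, actAt_one, mul_zero]
  -- This is the Leibniz rule for X k / X j = (X k / X i)(X i / X j), combined with the gluing
  -- condition between charts i and j.
  have hcoc : ∀ i j k, toFrac (X j) * T i k = toFrac (X i) * T j k - toFrac (X k) * T j i := by
    intro i j k
    have hr : sectionAt (ratio j k) η (hη j) =
        sectionAt (ratio i k) η (hη i) * sectionAt (ratio j i) η (hη j) := by
      apply germToFrac_injective η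
      have := hX i
      rw [map_mul, germToFrac_ratio, germToFrac_ratio, germToFrac_ratio]
      field_simp
    have h1 := hglue i j η (hη i) (hη j) (sectionAt (ratio i k) η (hη i))
    have h2 := actAt_mul (s j) η (hη j) (sectionAt (ratio i k) η (hη i))
      (sectionAt (ratio j i) η (hη j))
    rw [← hr, germToFrac_ratio, germToFrac_ratio] at h2
    rw [hT, hT, hT, h1, h2, div_pow]
    have hi := hX i
    have hj := hX j
    have him := pow_ne_zero m hi
    field_simp
    ring
  have hanti : ∀ i j, T i j = -T j i := fun i j => by
    have := hcoc i j j
    rw [hT0, mul_zero, zero_sub, ← mul_neg] at this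
    exact mul_left_cancel₀ (hX j) this
  -- T i j has only powers of X i in its denominator, and by antisymmetry only powers of X j; for i
  -- ≠ j these are coprime, so no denominator remains.
  have hpoly : ∀ i j, ∃ Q : CoordRing, toFrac Q = T i j := fun i j => by
    by_cases hij : i = j
    · exact ⟨0, by rw [hij, hT0, map_zero]⟩
    · have h1 : X i ^ (m + 2) * u i j * X j ^ n j i = X i ^ n i j * -(X j ^ (m + 2) * u j i) := by
        apply toFrac_injective
        have h2 := hanti i j
        have hi := pow_ne_zero (n i j) (hX i)
        have hj := pow_ne_zero (n j i) (hX j)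
        simp only [T] at h2
        simp only [map_mul, map_neg, map_pow]
        field_simp at h2
        linear_combination h2
      obtain ⟨Q, hQ⟩ := (isRelPrime_X_pow hij _ _).dvd_of_dvd_mul_right (Dvd.intro _ h1.symm)
      refine ⟨Q, ?_⟩
      have hi := pow_ne_zero (n i j) (hX i)
      have h3 := congrArg toFrac hQ
      simp only [map_mul, map_pow] at h3
      simp only [T]
      field_simp
      linear_combination -h3
  choose Q hQ using hpoly
  have hQhom : ∀ i j, (Q i j).IsHomogeneous (m + 2) := fun i j => by
    refine isHomogeneous_of_mul (isHomogeneous_X_pow i (n i j)) ?_ (pow_ne_zero _ (X_ne_zero i))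
    have : Q i j * X i ^ n i j = X i ^ (m + 2) * u i j := toFrac_injective (by
      have hi := pow_ne_zero (n i j) (hX i)
      simp only [map_mul, map_pow, hQ, T]
      field_simp)
    rw [this]
    exact (isHomogeneous_X_pow i _).mul (hu i j)
  obtain ⟨b, hb, hQb⟩ := exists_form_of_cocycle hQhom
    (fun i => toFrac_injective (by rw [hQ, hT0, map_zero]))
    (fun i j => toFrac_injective (by rw [map_neg, hQ, hQ, hanti]))
    (toFrac_injective (by
      simp only [map_add, map_mul, map_zero, hQ]
      linear_combination -hcoc 0 1 2 + toFrac (X 1) * hanti 0 2 + toFrac (X 2) * hanti 0 1))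
  refine ⟨b, hb, fun i j x hx => ?_⟩
  rw [hact, chartDer_ratio, ← hQb, hQ]
  have hi := hX i
  simp only [T]
  field_simp

theorem fieldAt_eq_germDer {f : CoordRing} {m : ℕ} {i : Fin 3}
    {D : Γ(logTangentSheaf f, chart i)} {b : Fin 3 → CoordRing}
    (hb : ∀ i, (b i).IsHomogeneous (m + 1))
    (h : ∀ j x hx, actAt D x hx (sectionAt (ratio i j) x hx) =
      chartDer b i m (toFrac (X j) / toFrac (X i))) (x : P2) (hx : x ∈ chart i) :
    fieldAt D x hx = germDer hb hx :=
  derivation_eq_of_ratio hx fun j => germToFrac_injective x (by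
    rw [germToFrac_germDer, germToFrac_ratio]
    exact h j x hx)

/-- If the vector field attached to `b` is logarithmic along `f = 0`, then `f` divides
`∑ bⱼ ∂ⱼ f`. -/
theorem dvd_polyDer {f : CoordRing} {d m : ℕ} (hhom : f.IsHomogeneous d) (hf0 : f ≠ 0)
    {b : Fin 3 → CoordRing} (hb : ∀ i, (b i).IsHomogeneous (m + 1))
    (h : ∀ i x (hx : x ∈ chart i), ∀ s ∈ curveIdeal f x, germDer hb hx s ∈ curveIdeal f x) :
    f ∣ polyDer b f := by
  refine dvd_of_local hhom (isHomogeneous_polyDer hb hhom) hf0 fun x => ?_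
  obtain ⟨i, hi⟩ := exists_mem_chart x
  have hXd := pow_notMem hi d
  -- The test element is f / X i ^ d, a local equation of the curve on the chart.
  obtain ⟨s, hs⟩ := exists_germ hhom (isHomogeneous_X_pow i d) hXd
  have hsI : s ∈ curveIdeal f x := mem_curveIdeal.mpr ⟨1, X i ^ d, hXd, by
    rw [hs, map_one]; ring⟩
  obtain ⟨p, c, hc, hpc⟩ := mem_curveIdeal.mp (h i x hi s hsI)
  rw [germToFrac_germDer, hs, chartDer_div _ _ _ _ (ne_zero_of_notMem hXd)] at hpc
  refine ⟨c * X i ^ d, mul_notMem hc hXd, ?_⟩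
  have hc0 := toFrac_ne_zero (ne_zero_of_notMem hc)
  have hden := toFrac_ne_zero
    (ne_zero_of_notMem (mul_notMem (pow_notMem hi m) (mul_notMem hXd hXd)))
  have key : (polyDer b f * X i ^ d - f * polyDer b (X i ^ d)) * c =
      f * p * (X i ^ m * (X i ^ d * X i ^ d)) := toFrac_injective (by
    rw [map_mul, map_mul, map_mul toFrac f]
    rw [div_eq_iff hden] at hpc
    rw [hpc]
    field_simp)
  exact ⟨p * (X i ^ m * (X i ^ d * X i ^ d)) + polyDer b (X i ^ d) * c, by
    linear_combination key⟩

/-- Every twisted global section of the sheaf of logarithmic vector fields comes from a syzygy. -/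
theorem exists_syzygy_of_twistedSections {f : CoordRing} {d m : ℕ} (hd : d ≠ 0)
    (hhom : f.IsHomogeneous d) (hf0 : f ≠ 0) {s : ∀ i, Γ(logTangentSheaf f, chart i)}
    (hs : s ∈ (Subsheaf.whole (logTangentSheaf f)).twistedSections m) :
    ∃ (b : Fin 3 → CoordRing) (hb : b ∈ syz f (m + 1)), s = chartField hb := by
  obtain ⟨b, hb, hact⟩ := exists_form_of_twistedSections hs
  obtain ⟨h, hh⟩ := dvd_polyDer hhom hf0 hb fun i x hx s' hs' => by
    rw [← fieldAt_eq_germDer hb (hact i) x hx]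
    exact (fieldAt_isLogField (s i)).preserves ⟨x, hx⟩ s' hs'
  have hhm : h.IsHomogeneous m := isHomogeneous_of_mul hhom (by
    rw [mul_comm, ← hh]
    exact isHomogeneous_polyDer hb hhom) hf0
  -- Subtracting h / d times the Euler field removes ∑ bⱼ∂ⱼf = f h and does not change the action on
  -- ratios of coordinates.
  let b' : Fin 3 → CoordRing := fun i => b i - C (1 / d : ℂ) * h * X i
  have hb' : b' ∈ syz f (m + 1) := by
    refine ⟨fun i => (hb i).sub ?_, ?_⟩
    · exact ((hhm.C_mul _)).mul (isHomogeneous_X ℂ i)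
    · have h1 := hhom.sum_X_mul_pderiv
      rw [polyDer_apply] at hh
      have h2 : C (1 / d : ℂ) * (d • f) = f := by
        rw [← Nat.cast_smul_eq_nsmul ℂ, smul_eq_C_mul, ← mul_assoc, ← C_mul,
          one_div_mul_cancel (Nat.cast_ne_zero.mpr hd), C_1, one_mul]
      simp only [b', sub_mul, Finset.sum_sub_distrib, hh]
      simp only [mul_assoc, ← Finset.mul_sum]
      rw [h1, mul_left_comm, h2, mul_comm h, sub_self]
  refine ⟨b', hb', funext fun i => fieldAt_ext fun x hx => ?_⟩
  refine fieldAt_eq_germDer hb'.1 (fun j y hy => ?_) x hx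
  rw [hact, chartDer_ratio, chartDer_ratio]
  congr 2
  simp only [b']
  ring

/-- A field that kills all ratios has b proportional to (X₀, X₁, X₂), so b = w X; the syzygy
relation becomes w · d f = 0 and forces w = 0. -/
theorem chartFields_injective {f : CoordRing} {d : ℕ} (hd : d ≠ 0) (hhom : f.IsHomogeneous d)
    (hf0 : f ≠ 0) (m : ℕ) : Function.Injective (chartFields f m) := by
  rw [injective_iff_map_eq_zero]
  rintro ⟨b, hb⟩ h
  obtain ⟨η, hη⟩ := exists_generic_point
  have hX := toFrac_X_ne_zero
  have hprop : ∀ i j, b j * X i = b i * X j := fun i j => by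
    have h1 : actAt (chartField hb i) η (hη i) (sectionAt (ratio i j) η (hη i)) = 0 := by
      have : chartField hb i = 0 := congrFun h i
      rw [this]
      exact map_zero (germToFrac η)
    rw [actAt_chartField, germToFrac_ratio, chartDer_ratio, div_eq_zero_iff] at h1
    have h2 := h1.resolve_right (pow_ne_zero _ (hX i))
    exact sub_eq_zero.mp (toFrac_injective (h2.trans (map_zero _).symm))
  obtain ⟨w, hw⟩ := exists_eq_X_pow_mul 1 (v := b) fun i j => by
    rw [pow_one, pow_one, mul_comm, ← hprop, mul_comm]
  have hw0 : w = 0 := by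
    have h1 := hb.2
    simp only [hw, pow_one, mul_comm _ w, mul_assoc, ← Finset.mul_sum] at h1
    rw [hhom.sum_X_mul_pderiv] at h1
    exact (mul_eq_zero.mp h1).resolve_right fun h0 => hf0 ((smul_eq_zero.mp h0).resolve_left hd)
  refine Subtype.ext (funext fun i => ?_)
  change b i = 0
  rw [hw, hw0, mul_zero]

/-- The syzygies of degree `m + 1` that correspond to the global sections of the `m`-th twist of a
subsheaf. -/
def formSections {f : CoordRing} (F : Subsheaf (logTangentSheaf f)) (m : ℕ) :
    Submodule ℂ (Fin 3 → CoordRing) :=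
  ((F.twistedSections m).comap (chartFields f m)).map (syz f (m + 1)).subtype

theorem mem_formSections {f : CoordRing} {F : Subsheaf (logTangentSheaf f)} {m : ℕ}
    {b : Fin 3 → CoordRing} : b ∈ formSections F m ↔
      ∃ hb : b ∈ syz f (m + 1), ∀ i, chartField hb i ∈ F.sections (chart i) := by
  constructor
  · rintro ⟨b, hb, rfl⟩
    exact ⟨b.2, (chartField_mem_twistedSections b.2 F).mp hb⟩
  · rintro ⟨hb, h⟩
    exact ⟨⟨b, hb⟩, (chartField_mem_twistedSections hb F).mpr h, rfl⟩

theorem formSections_le {f : CoordRing} (F : Subsheaf (logTangentSheaf f)) (m : ℕ) :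
    formSections F m ≤ syz f (m + 1) := fun _ hb => (mem_formSections.mp hb).1

theorem formSections_whole (f : CoordRing) (m : ℕ) :
    formSections (Subsheaf.whole (logTangentSheaf f)) m = syz f (m + 1) :=
  le_antisymm (formSections_le _ m) fun _ hb => mem_formSections.mpr ⟨hb, fun _ => trivial⟩

/-- The global sections of a twist of a subsheaf form a space of syzygies. -/
theorem nonempty_equiv_formSections {f : CoordRing} {d : ℕ} (hd : d ≠ 0)
    (hhom : f.IsHomogeneous d) (hf0 : f ≠ 0) (F : Subsheaf (logTangentSheaf f)) (m : ℕ) :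
    Nonempty (formSections F m ≃ₗ[ℂ] F.twistedSections m) := by
  have hmap : ((F.twistedSections m).comap (chartFields f m)).map (chartFields f m) =
      F.twistedSections m := by
    refine le_antisymm (Submodule.map_comap_le _ _) fun s hs => ?_
    obtain ⟨b, hb, rfl⟩ := exists_syzygy_of_twistedSections hd hhom hf0 (s := s) (m := m)
      ⟨fun _ => trivial, hs.2⟩
    exact ⟨⟨b, hb⟩, hs, rfl⟩
  exact ⟨(Submodule.equivMapOfInjective _ (Submodule.injective_subtype _) _).symm.trans
    ((Submodule.equivMapOfInjective _ (chartFields_injective hd hhom hf0 m) _).trans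
      (LinearEquiv.ofEq _ _ hmap))⟩

/-- The multiplier r is h / X i ^ k: the power of X i in the denominator grows from m to m + k. -/
theorem chartField_mul {f : CoordRing} {m k : ℕ} {b : Fin 3 → CoordRing}
    (hb : b ∈ syz f (m + 1)) {h : CoordRing} (hh : h.IsHomogeneous k)
    (hhb : (fun j => h * b j) ∈ syz f (m + k + 1)) (i : Fin 3) :
    ∃ r : Γ(P2, chart i), chartField hhb i = r • chartField hb i := by
  choose g hg using fun (x : P2) (hx : x ∈ chart i) =>
    exists_germ hh (isHomogeneous_X_pow i k) (pow_notMem hx k)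
  obtain ⟨r, hr⟩ := exists_section g fun x hx =>
    ⟨chart i, le_rfl, k, h, X i ^ k, hx, hh, isHomogeneous_X_pow i k, fun y _ hy =>
      ⟨pow_notMem hy k, hg y hy⟩⟩
  refine ⟨r, section_eq_iff.mpr fun x hx s => ?_⟩
  rw [actAt_smul, actAt_chartField, actAt_chartField, hr, hg, chartDer_smul, chartDer_apply,
    chartDer_apply, map_pow, map_pow, map_pow]
  have := toFrac_X_ne_zero i
  field_simp
  ring

theorem syz_mul {f : CoordRing} {n k : ℕ} {b : Fin 3 → CoordRing} (hb : b ∈ syz f n)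
    {h : CoordRing} (hh : h.IsHomogeneous k) : (fun j => h * b j) ∈ syz f (n + k) := by
  refine ⟨fun i => ?_, ?_⟩
  · rw [add_comm]
    exact hh.mul (hb.1 i)
  · simp only [mul_assoc, ← Finset.mul_sum, hb.2, mul_zero]

theorem formSections_mul {f : CoordRing} {F : Subsheaf (logTangentSheaf f)} {m k : ℕ}
    {b : Fin 3 → CoordRing} (hb : b ∈ formSections F m) {h : CoordRing} (hh : h.IsHomogeneous k) :
    (fun j => h * b j) ∈ formSections F (m + k) := by
  obtain ⟨hb, hF⟩ := mem_formSections.mp hb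
  have hhb : (fun j => h * b j) ∈ syz f (m + k + 1) := by
    have := syz_mul hb hh
    rwa [add_right_comm] at this
  refine mem_formSections.mpr ⟨hhb, fun i => ?_⟩
  obtain ⟨r, hr⟩ := chartField_mul hb hh hhb i
  rw [hr]
  exact Submodule.smul_mem _ _ (hF i)

/-! ### Primitive vectors of forms -/

/-- The ring homomorphism `Xᵢ ↦ Xᵢ T`, which separates the homogeneous components. -/
def separate : CoordRing →+* Polynomial CoordRing :=
  eval₂Hom (Polynomial.C.comp C) fun i => Polynomial.C (X i) * Polynomial.X

theorem separate_monomial (s : Fin 3 →₀ ℕ) (r : ℂ) :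
    separate (monomial s r) = Polynomial.C (monomial s r) * Polynomial.X ^ s.degree := by
  rw [separate, eval₂Hom_monomial, monomial_eq, Polynomial.C_mul, RingHom.comp_apply, mul_assoc]
  congr 1
  simp only [Finsupp.prod, mul_pow, Finset.prod_mul_distrib, Finset.prod_pow_eq_pow_sum, map_prod,
    map_pow]
  rfl

theorem coeff_separate (p : CoordRing) (n : ℕ) :
    (separate p).coeff n = homogeneousComponent n p := by
  induction p using MvPolynomial.induction_on' with
  | monomial s r =>
    rw [separate_monomial, Polynomial.coeff_C_mul_X_pow,
      homogeneousComponent_of_mem (isHomogeneous_monomial r rfl)]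
  | add p q hp hq => rw [map_add, Polynomial.coeff_add, hp, hq, map_add]

theorem separate_of_isHomogeneous {p : CoordRing} {n : ℕ} (hp : p.IsHomogeneous n) :
    separate p = Polynomial.C p * Polynomial.X ^ n := by
  ext1 k
  rw [coeff_separate, Polynomial.coeff_C_mul_X_pow, homogeneousComponent_of_mem hp]

/-- A factor of a nonzero form is a form. -/
theorem exists_isHomogeneous_of_mul {p q : CoordRing} {n : ℕ} (h : (p * q).IsHomogeneous n)
    (h0 : p * q ≠ 0) : ∃ e, p.IsHomogeneous e := by
  have hsep : ∀ {r : CoordRing}, r ≠ 0 → separate r ≠ 0 := fun {r} hr hr0 => hr <| by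
    rw [← sum_homogeneousComponent r]
    exact Finset.sum_eq_zero fun k _ => by rw [← coeff_separate, hr0, Polynomial.coeff_zero]
  have hp := hsep (left_ne_zero_of_mul h0)
  have hq := hsep (right_ne_zero_of_mul h0)
  -- The product is a single monomial in T. Top degrees and lowest degrees both add, so they
  -- coincide for each factor, which is therefore a monomial in T as well.
  have hmul : separate p * separate q = Polynomial.C (p * q) * Polynomial.X ^ n := by
    rw [← map_mul, separate_of_isHomogeneous h]
  have h1 := Polynomial.natDegree_mul hp hq
  have h2 := Polynomial.natTrailingDegree_mul hp hq
  rw [hmul, Polynomial.natDegree_C_mul_X_pow _ _ h0] at h1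
  rw [hmul, Polynomial.natTrailingDegree_mul_X_pow (Polynomial.C_ne_zero.mpr h0),
    Polynomial.natTrailingDegree_C, zero_add] at h2
  have h3 := (separate p).natTrailingDegree_le_natDegree
  have h4 := (separate q).natTrailingDegree_le_natDegree
  refine ⟨(separate p).natDegree, ?_⟩
  have hz : ∀ k, k ≠ (separate p).natDegree → homogeneousComponent k p = 0 := fun k hk => by
    rw [← coeff_separate]
    rcases lt_or_gt_of_ne hk with hlt | hgt
    · exact Polynomial.coeff_eq_zero_of_lt_natTrailingDegree (by omega)
    · exact Polynomial.coeff_eq_zero_of_natDegree_lt hgt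
  intro s hs
  by_contra hne
  have := congrArg (coeff s) (hz s.degree (by
    rwa [Finsupp.degree_eq_weight_one]))
  rw [coeff_homogeneousComponent, if_pos rfl, coeff_zero] at this
  exact hs this

/-- A nonzero vector of forms is a multiple of a primitive vector of forms. -/
theorem exists_primitive {b : Fin 3 → CoordRing} {n : ℕ} (hb : ∀ i, (b i).IsHomogeneous n)
    (hb0 : b ≠ 0) : ∃ (k e : ℕ) (g : CoordRing) (a : Fin 3 → CoordRing), k + e = n ∧
      g.IsHomogeneous e ∧ g ≠ 0 ∧ (∀ i, (a i).IsHomogeneous k) ∧ (∀ i, b i = g * a i) ∧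
      ∀ p, Prime p → ∃ i, ¬ p ∣ a i := by
  classical
  obtain ⟨i₀, hi₀⟩ : ∃ i, b i ≠ 0 := by
    by_contra! h
    exact hb0 (funext h)
  let _ : StrongNormalizationMonoid CoordRing :=
    UniqueFactorizationMonoid.strongNormalizationMonoid
  let _ : NormalizedGCDMonoid CoordRing := UniqueFactorizationMonoid.toNormalizedGCDMonoid CoordRing
  obtain ⟨a, ha, hgcd⟩ := Finset.extract_gcd b (s := Finset.univ) Finset.univ_nonempty
  set g := Finset.univ.gcd b
  have hg : ∀ i, b i = g * a i := fun i => ha i (Finset.mem_univ i)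
  have hg0 : g ≠ 0 := fun h => hi₀ (by rw [hg, h, zero_mul])
  obtain ⟨e, he⟩ := exists_isHomogeneous_of_mul (hg i₀ ▸ hb i₀) (hg i₀ ▸ hi₀)
  have hen : e ≤ n := by
    rw [← he.totalDegree hg0, ← (hb i₀).totalDegree hi₀, hg i₀,
      totalDegree_mul_of_isDomain hg0 (right_ne_zero_of_mul (hg i₀ ▸ hi₀))]
    omega
  refine ⟨n - e, e, g, a, by omega, he, hg0, fun i => isHomogeneous_of_mul he ?_ hg0, hg,
    fun p hp => ?_⟩
  · rw [mul_comm, ← hg, Nat.sub_add_cancel hen]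
    exact hb i
  · by_contra! h
    exact hp.not_isUnit (isUnit_of_dvd_one (hgcd ▸ Finset.dvd_gcd fun i _ => h i))

/-! ### Comparison of polynomials by their values at large integers -/

theorem leadingCoeff_nonneg_of_eventually {u : Polynomial ℚ}
    (h : ∀ᶠ m : ℕ in Filter.atTop, 0 ≤ u.eval (m : ℚ)) : 0 ≤ u.leadingCoeff := by
  by_contra! hneg
  rcases le_or_gt u.degree 0 with hdeg | hdeg
  · rw [Polynomial.eq_C_of_degree_le_zero hdeg] at h hneg
    obtain ⟨m, hm⟩ := h.exists
    rw [Polynomial.eval_C] at hm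
    rw [Polynomial.leadingCoeff_C] at hneg
    exact absurd hm (not_le.mpr hneg)
  · have ht := (u.tendsto_atBot_of_leadingCoeff_nonpos hdeg hneg.le).comp
      (tendsto_natCast_atTop_atTop (R := ℚ))
    obtain ⟨m, hm, hm'⟩ := (h.and (ht.eventually_lt_atBot 0)).exists
    exact absurd hm (not_le.mpr hm')

theorem coeff_two_nonneg {u : Polynomial ℚ} (hu : u.natDegree ≤ 2)
    (h : ∀ᶠ m : ℕ in Filter.atTop, 0 ≤ u.eval (m : ℚ)) : 0 ≤ u.coeff 2 := by
  by_cases h2 : u.coeff 2 = 0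
  · exact h2.ge
  · have := leadingCoeff_nonneg_of_eventually h
    rwa [Polynomial.leadingCoeff,
      le_antisymm hu (Polynomial.le_natDegree_of_ne_zero h2)] at this

theorem coeff_one_nonneg {u : Polynomial ℚ} (hu : u.natDegree ≤ 2) (h2 : u.coeff 2 = 0)
    (h : ∀ᶠ m : ℕ in Filter.atTop, 0 ≤ u.eval (m : ℚ)) : 0 ≤ u.coeff 1 := by
  by_cases h1 : u.coeff 1 = 0
  · exact h1.ge
  · have hu1 : u.natDegree ≤ 1 := by
      refine Polynomial.natDegree_le_iff_coeff_eq_zero.mpr fun n hn => ?_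
      rcases eq_or_lt_of_le (Nat.succ_le_of_lt hn) with rfl | hn'
      · exact h2
      · exact Polynomial.coeff_eq_zero_of_natDegree_lt (lt_of_le_of_lt hu hn')
    have := leadingCoeff_nonneg_of_eventually h
    rwa [Polynomial.leadingCoeff,
      le_antisymm hu1 (Polynomial.le_natDegree_of_ne_zero h1)] at this

/-- `rank` and `degree` read fixed coefficients, so they describe leading behaviour only once the
degree is bounded; for a subsheaf the bound comes from the Hilbert polynomial of the whole sheaf. -/
theorem natDegree_le_two_of_bounded {q r : Polynomial ℚ} (hr : r.natDegree ≤ 2)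
    (h0 : ∀ᶠ m : ℕ in Filter.atTop, 0 ≤ q.eval (m : ℚ))
    (h : ∀ᶠ m : ℕ in Filter.atTop, q.eval (m : ℚ) ≤ r.eval (m : ℚ)) : q.natDegree ≤ 2 := by
  by_contra! hq
  have h1 := leadingCoeff_nonneg_of_eventually h0
  have h2 := leadingCoeff_nonneg_of_eventually (u := r - q)
    (h.mono fun m hm => by rw [Polynomial.eval_sub]; exact sub_nonneg.mpr hm)
  rw [Polynomial.leadingCoeff_sub_of_degree_lt'
    (Polynomial.degree_lt_degree (lt_of_le_of_lt hr hq))] at h2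
  have h3 : q.leadingCoeff = 0 := le_antisymm (neg_nonneg.mp h2) h1
  rw [Polynomial.leadingCoeff_eq_zero.mp h3, Polynomial.natDegree_zero] at hq
  omega

theorem eq_of_eventually_eval_eq {q r : Polynomial ℚ}
    (h : ∀ᶠ m : ℕ in Filter.atTop, q.eval (m : ℚ) = r.eval (m : ℚ)) : q = r := by
  obtain ⟨N, hN⟩ := Filter.eventually_atTop.mp h
  refine Polynomial.eq_of_infinite_eval_eq q r (Set.Infinite.mono (s := Nat.cast '' Set.Ici N) ?_
    ((Set.Ici_infinite N).image Nat.cast_injective.injOn))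
  rintro _ ⟨m, hm, rfl⟩
  exact hN m hm

/-- The Hilbert polynomial of `𝒪(c)` on the plane. -/
def twistPoly (c : ℚ) : Polynomial ℚ :=
  Polynomial.C (1 / 2) * Polynomial.X ^ 2 + Polynomial.C (c + 3 / 2) * Polynomial.X +
    Polynomial.C ((c + 2) * (c + 1) / 2)

theorem twistPoly_coeff_two (c : ℚ) : (twistPoly c).coeff 2 = 1 / 2 := by
  simp [twistPoly]

theorem twistPoly_coeff_one (c : ℚ) : (twistPoly c).coeff 1 = c + 3 / 2 := by
  simp [twistPoly, Polynomial.coeff_C, Polynomial.coeff_X_pow]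

theorem natDegree_twistPoly (c : ℚ) : (twistPoly c).natDegree ≤ 2 := by
  unfold twistPoly
  compute_degree

theorem twistPoly_eval {c : ℚ} {m n : ℕ} (h : (n : ℚ) = m + c) :
    (twistPoly c).eval (m : ℚ) = ((n + 2).choose 2 : ℕ) := by
  rw [Nat.cast_choose_two]
  simp only [twistPoly, Polynomial.eval_add, Polynomial.eval_mul, Polynomial.eval_C,
    Polynomial.eval_pow, Polynomial.eval_X]
  push_cast
  rw [h]
  ring

/-! ### Spaces of multiples of a vector of forms -/

/-- Multiplication of a fixed vector by polynomials. -/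
def mulVec (a : Fin 3 → CoordRing) : CoordRing →ₗ[ℂ] (Fin 3 → CoordRing) :=
  LinearMap.pi fun i => LinearMap.mulRight ℂ (a i)

theorem mulVec_apply (a : Fin 3 → CoordRing) (h : CoordRing) (i : Fin 3) :
    mulVec a h i = h * a i := rfl

theorem mulVec_injective {a : Fin 3 → CoordRing} {i : Fin 3} (ha : a i ≠ 0) :
    Function.Injective (mulVec a) := fun _ _ h =>
  mul_right_cancel₀ ha (congrFun h i)

/-- The multiples of `a` by the forms of degree `n`. -/
abbrev multiples (a : Fin 3 → CoordRing) (n : ℕ) : Submodule ℂ (Fin 3 → CoordRing) :=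
  (homogeneousSubmodule (Fin 3) ℂ n).map (mulVec a)

theorem finrank_multiples {a : Fin 3 → CoordRing} {i : Fin 3} (ha : a i ≠ 0) (n : ℕ) :
    Module.finrank ℂ (multiples a n) = (n + 2).choose 2 :=
  (Submodule.equivMapOfInjective _ (mulVec_injective ha) _).finrank_eq.symm.trans
    (finrank_homogeneousSubmodule n)

/-! ### Hilbert polynomials of subsheaves of the logarithmic tangent sheaf -/

section

variable {f : CoordRing} {d : ℕ}

theorem finite_syz (hhom : f.IsHomogeneous d) (n : ℕ) : Module.Finite ℂ (syz f n) :=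
  syzygies_finite (fun _ => hhom.pderiv) n

theorem finite_formSections (hhom : f.IsHomogeneous d) (F : Subsheaf (logTangentSheaf f)) (m : ℕ) :
    Module.Finite ℂ (formSections F m) :=
  have := finite_syz hhom (m + 1)
  Submodule.finiteDimensional_of_le (formSections_le F m)

/-- Finite dimensionality is automatic inside the syzygies of a fixed degree, so only the count
matters. -/
theorem isHilbertPolynomial_iff (hd : d ≠ 0) (hhom : f.IsHomogeneous d) (hf0 : f ≠ 0)
    {F : Subsheaf (logTangentSheaf f)} {q : Polynomial ℚ} :
    F.IsHilbertPolynomial q ↔ ∀ᶠ m : ℕ in Filter.atTop,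
      (Module.finrank ℂ (formSections F m) : ℚ) = q.eval (m : ℚ) := by
  refine Filter.eventually_congr (Filter.Eventually.of_forall fun m => ?_)
  obtain ⟨φ⟩ := nonempty_equiv_formSections hd hhom hf0 F m
  have := finite_formSections hhom F m
  rw [← φ.finrank_eq, and_iff_right (Module.Finite.equiv φ)]

/-- The Hilbert polynomial of the logarithmic tangent sheaf. -/
theorem exists_isHilbertPolynomial_whole (hd : d ≠ 0) (hhom : f.IsHomogeneous d)
    (hred : Squarefree f) : ∃ p : Polynomial ℚ,
      (Subsheaf.whole (logTangentSheaf f)).IsHilbertPolynomial p ∧ p.natDegree ≤ 2 ∧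
        rank p = 2 ∧ slope p = (3 - d) / 2 := by
  obtain ⟨t, ht⟩ := exists_finrank_syzygies (exists_not_dvd_pderiv hd hhom hred)
    (e := d - 1) (fun _ => hhom.pderiv)
  -- The syzygies have degree n = m + 1 and the partial derivatives degree d - 1, so the target
  -- forms have degree m + d: this accounts for the twists 1 and d.
  refine ⟨Polynomial.C 3 * twistPoly 1 - twistPoly d + Polynomial.C (t : ℚ), ?_, ?_, ?_⟩
  · rw [isHilbertPolynomial_iff hd hhom hred.ne_zero]
    filter_upwards [(Filter.tendsto_add_atTop_nat 1).eventually ht] with m hm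
    have hm : Module.finrank ℂ (syz f (m + 1)) + (m + d + 2).choose 2 =
        3 * (m + 1 + 2).choose 2 + t := by
      rw [← hm]
      congr 3
      omega
    rw [formSections_whole, Polynomial.eval_add, Polynomial.eval_sub, Polynomial.eval_mul,
      Polynomial.eval_C, Polynomial.eval_C, twistPoly_eval (n := m + 1) (by push_cast; rfl),
      twistPoly_eval (n := m + d) (by push_cast; rfl)]
    have := congrArg (Nat.cast : ℕ → ℚ) hm
    push_cast at this ⊢
    linarith
  · have h1 := natDegree_twistPoly 1
    have h2 := natDegree_twistPoly d
    refine (Polynomial.natDegree_add_C).trans_le ((Polynomial.natDegree_sub_le _ _).trans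
      (max_le ((Polynomial.natDegree_C_mul_le _ _).trans h1) h2))
  · have h : rank (Polynomial.C 3 * twistPoly 1 - twistPoly d + Polynomial.C (t : ℚ)) = 2 := by
      rw [rank, Polynomial.coeff_add, Polynomial.coeff_sub, Polynomial.coeff_C_mul,
        twistPoly_coeff_two, twistPoly_coeff_two, Polynomial.coeff_C]
      norm_num
    refine ⟨h, ?_⟩
    rw [slope, degree, h, Polynomial.coeff_add, Polynomial.coeff_sub, Polynomial.coeff_C_mul,
      twistPoly_coeff_one, twistPoly_coeff_one, Polynomial.coeff_C]
    norm_num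
    ring

theorem mem_formSections_spec {F : Subsheaf (logTangentSheaf f)} {m : ℕ} {b : Fin 3 → CoordRing}
    (hb : b ∈ formSections F m) :
    (∀ i, (b i).IsHomogeneous (m + 1)) ∧ ∑ i, b i * pderiv i f = 0 :=
  formSections_le F m hb

/-- Multiplication by a power of X₀ raises the degree, so excluding degree e excludes all smaller
degrees too. -/
theorem hasSyzygy_of_le {a : Fin 3 → CoordRing} {k e : ℕ} (hke : k ≤ e)
    (ha : ∀ i, (a i).IsHomogeneous k) (ha0 : a ≠ 0) (h : ∑ i, a i * pderiv i f = 0) :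
    HasSyzygy f e := by
  refine ⟨fun i => X 0 ^ (e - k) * a i, fun i => ?_, fun h0 => ha0 (funext fun i => ?_), ?_⟩
  · have := ((isHomogeneous_X ℂ (0 : Fin 3)).pow (e - k)).mul (ha i)
    rwa [one_mul, Nat.sub_add_cancel hke] at this
  · exact (mul_eq_zero.mp (congrFun h0 i)).resolve_left (pow_ne_zero _ (X_ne_zero 0))
  · simp only [mul_assoc, ← Finset.mul_sum, h, mul_zero]

theorem multiples_le_formSections {F : Subsheaf (logTangentSheaf f)} {m₀ m : ℕ}
    {b : Fin 3 → CoordRing} (hb : b ∈ formSections F m₀) (hm : m₀ ≤ m) :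
    multiples b (m - m₀) ≤ formSections F m := by
  rintro _ ⟨h, hh, rfl⟩
  have := formSections_mul hb (h := h) hh
  rwa [Nat.add_sub_cancel' hm] at this

/-- A subsheaf of small rank has small slope if there is no syzygy of small degree. -/
theorem slope_lt_of_not_hasSyzygy (hd : d ≠ 0) (hhom : f.IsHomogeneous d) (hred : Squarefree f)
    {e : ℕ} (hde : d ≤ 2 * e + 2) (he : ¬ HasSyzygy f e) {F : Subsheaf (logTangentSheaf f)}
    {q : Polynomial ℚ} (hq : F.IsHilbertPolynomial q) (hq0 : 0 < rank q) (hq2 : rank q < 2) :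
    slope q < (3 - d) / 2 := by
  obtain ⟨p, hp, hp2, -⟩ := exists_isHilbertPolynomial_whole hd hhom hred
  rw [isHilbertPolynomial_iff hd hhom hred.ne_zero] at hp hq
  have hdeg : q.natDegree ≤ 2 := by
    refine natDegree_le_two_of_bounded hp2 (hq.mono fun m hm => hm ▸ Nat.cast_nonneg _) ?_
    filter_upwards [hp, hq] with m hpm hqm
    rw [← hpm, ← hqm, formSections_whole, Nat.cast_le]
    have := finite_syz hhom (m + 1)
    exact Submodule.finrank_mono (formSections_le F m)
  -- a nonzero section of a twist, and the primitive syzygy it is a multiple of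
  obtain ⟨m₀, b, hb, hb0⟩ : ∃ m₀, ∃ b ∈ formSections F m₀, b ≠ 0 := by
    by_contra! h
    have : q = 0 := eq_of_eventually_eval_eq <| hq.mono fun m hm => by
      rw [← hm, (Submodule.eq_bot_iff _).mpr (h m), finrank_bot, Polynomial.eval_zero,
        Nat.cast_zero]
    rw [this, rank, Polynomial.coeff_zero, mul_zero] at hq0
    exact lt_irrefl _ hq0
  obtain ⟨hbhom, hbsyz⟩ := mem_formSections_spec hb
  obtain ⟨k, l, g, a, hkl, hg, hg0, ha, hba, hprim⟩ := exists_primitive hbhom hb0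
  obtain ⟨i, hbi⟩ : ∃ i, b i ≠ 0 := by
    by_contra! h
    exact hb0 (funext h)
  have hai : a i ≠ 0 := right_ne_zero_of_mul (hba i ▸ hbi)
  have hasyz : ∑ j, a j * pderiv j f = 0 := by
    refine (mul_eq_zero.mp ?_).resolve_left hg0
    rw [Finset.mul_sum, ← hbsyz]
    exact Finset.sum_congr rfl fun j _ => by rw [hba, mul_assoc]
  have hek : e < k := by
    by_contra! hke
    exact he (hasSyzygy_of_le hke ha (fun h => hai (congrFun h i)) hasyz)
  have hlow : ∀ {m₁ m : ℕ}, m₁ ≤ m →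
      (twistPoly (-m₁)).eval (m : ℚ) = ((m - m₁ + 2).choose 2 : ℕ) := fun h =>
    twistPoly_eval (by rw [Nat.cast_sub h]; ring)
  by_cases hmul : ∀ m, ∀ b' ∈ formSections F m, ∃ w, ∀ j, b' j = w * a j
  · -- all sections are multiples of `a`
    have hle : ∀ᶠ m : ℕ in Filter.atTop, 0 ≤ (twistPoly (1 - k) - q).eval (m : ℚ) := by
      filter_upwards [hq, Filter.eventually_ge_atTop k] with m hm hkm
      rw [Polynomial.eval_sub, ← hm, twistPoly_eval (n := m + 1 - k)
        (by rw [Nat.cast_sub (by omega)]; push_cast; ring), sub_nonneg, Nat.cast_le,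
        ← finrank_multiples hai]
      refine Submodule.finrank_mono fun b' hb' => ?_
      obtain ⟨w, hw⟩ := hmul m b' hb'
      refine ⟨w, isHomogeneous_of_mul (ha i) ?_ hai, funext fun j => (hw j).symm⟩
      rw [← hw, Nat.sub_add_cancel (by omega)]
      exact (mem_formSections_spec hb').1 i
    -- Multiples of b give a lower bound by 𝒪(-m₀). Together with the upper bound by 𝒪(1 - k), this
    -- fixes the quadratic coefficient at 1/2, after which the linear coefficients can be compared.
    have hge : ∀ᶠ m : ℕ in Filter.atTop, 0 ≤ (q - twistPoly (-m₀)).eval (m : ℚ) := by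
      filter_upwards [hq, Filter.eventually_ge_atTop m₀] with m hm hkm
      rw [Polynomial.eval_sub, ← hm, hlow hkm, sub_nonneg, Nat.cast_le,
        ← finrank_multiples hbi]
      have := finite_formSections hhom F m
      exact Submodule.finrank_mono (multiples_le_formSections hb hkm)
    have hdle : (twistPoly (1 - k) - q).natDegree ≤ 2 :=
      (Polynomial.natDegree_sub_le _ _).trans (max_le (natDegree_twistPoly _) hdeg)
    have hdge : (q - twistPoly (-m₀)).natDegree ≤ 2 :=
      (Polynomial.natDegree_sub_le _ _).trans (max_le hdeg (natDegree_twistPoly _))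
    have h1 := coeff_two_nonneg hdle hle
    have h2 := coeff_two_nonneg hdge hge
    rw [Polynomial.coeff_sub, twistPoly_coeff_two] at h1 h2
    have h3 : q.coeff 2 = 1 / 2 := by linarith
    have h4 := coeff_one_nonneg hdle
      (by rw [Polynomial.coeff_sub, twistPoly_coeff_two, h3, sub_self]) hle
    rw [Polynomial.coeff_sub, twistPoly_coeff_one] at h4
    have h5 : (e : ℚ) + 1 ≤ k := by exact_mod_cast hek
    have h6 : (d : ℚ) ≤ 2 * e + 2 := by exact_mod_cast hde
    -- The chain is slope q ≤ 1 - k ≤ -e ≤ (2 - d)/2 < (3 - d)/2.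
    rw [slope, degree, rank, h3]
    norm_num
    linarith
  · -- there are two independent sections
    push Not at hmul
    obtain ⟨m₁, b', hb', hne⟩ := hmul
    obtain ⟨i', hbi'⟩ : ∃ i, b' i ≠ 0 := by
      by_contra! h
      obtain ⟨j, hj⟩ := hne 0
      exact hj (by rw [h, zero_mul])
    -- A nonzero common multiple of b and b' would make b' proportional to the primitive vector a,
    -- hence a multiple of it.
    have hdisj : ∀ n n', Disjoint (multiples b n) (multiples b' n') := fun n n' => by
      rw [Submodule.disjoint_def]
      rintro _ ⟨h, -, rfl⟩ ⟨h', -, heq⟩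
      have heq : ∀ j, h' * b' j = h * (g * a j) := fun j => by
        rw [← hba]; exact congrFun heq j
      by_contra hne0
      have hh' : h' ≠ 0 := fun h0 => hne0 (funext fun j => by
        rw [mulVec_apply, hba, ← heq, h0, zero_mul]; rfl)
      obtain ⟨w, hw⟩ := exists_eq_mul_of_proportional hprim hai (v := b') fun j k =>
        mul_left_cancel₀ hh' (by rw [← mul_assoc, ← mul_assoc, heq, heq]; ring)
      obtain ⟨j, hj⟩ := hne w
      exact hj (hw j)
    -- The two disjoint families of multiples count as 𝒪(-m₀) ⊕ 𝒪(-m₁), which forces rank at least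
    -- 2.
    have hge : ∀ᶠ m : ℕ in Filter.atTop,
        0 ≤ (q - (twistPoly (-m₀) + twistPoly (-m₁))).eval (m : ℚ) := by
      filter_upwards [hq, Filter.eventually_ge_atTop m₀, Filter.eventually_ge_atTop m₁]
        with m hm hm₀ hm₁
      rw [Polynomial.eval_sub, Polynomial.eval_add, ← hm, hlow hm₀, hlow hm₁,
        sub_nonneg, ← Nat.cast_add, Nat.cast_le, ← finrank_multiples hbi, ← finrank_multiples hbi',
        ← Submodule.finrank_sup_add_finrank_inf_eq, (hdisj _ _).eq_bot, finrank_bot, add_zero]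
      have := finite_formSections hhom F m
      exact Submodule.finrank_mono
        (sup_le (multiples_le_formSections hb hm₀) (multiples_le_formSections hb' hm₁))
    have h2 := coeff_two_nonneg ((Polynomial.natDegree_sub_le _ _).trans (max_le hdeg
      ((Polynomial.natDegree_add_le _ _).trans
        (max_le (natDegree_twistPoly _) (natDegree_twistPoly _))))) hge
    rw [Polynomial.coeff_sub, Polynomial.coeff_add, twistPoly_coeff_two, twistPoly_coeff_two] at h2
    rw [rank] at hq2
    linarith

end

/-! ### The rank one subsheaf generated by a syzygy -/

/-- On `W`, the vector field `D` is the multiple `(p / q) ∑ aⱼ ∂ⱼ` of a vector `a` of forms of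
degree `k`. -/
def IsFractionOn {f : CoordRing} {U : P2.Opens} (D : Γ(logTangentSheaf f, U))
    (a : Fin 3 → CoordRing) (k : ℕ) (W : P2.Opens) : Prop :=
  -- The equation n + k = n' + 1 says that (p / q) ∑ aⱼ∂ⱼ has degree 0, since each ∂ⱼ lowers degrees
  -- by one.
  ∃ (n n' : ℕ) (p q : CoordRing), n + k = n' + 1 ∧ p.IsHomogeneous n ∧ q.IsHomogeneous n' ∧
    ∀ y ∈ W, ∀ hy : y ∈ U, q ∉ pointIdeal y ∧
      ∀ s, actAt D y hy s = toFrac p / toFrac q * fracDer (polyDer a) (germToFrac y s)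

theorem isFractionOn_zero {f : CoordRing} {U : P2.Opens} (a : Fin 3 → CoordRing) (k : ℕ)
    (i : Fin 3) : IsFractionOn (0 : Γ(logTangentSheaf f, U)) a k (chart i) := by
  refine ⟨1, k, 0, X i ^ k, add_comm 1 k, isHomogeneous_zero _ _ _, isHomogeneous_X_pow i k,
    fun y hyi hy => ⟨pow_notMem hyi k, fun s => ?_⟩⟩
  rw [map_zero, zero_div, zero_mul]
  exact left_eq_add.mp ((congrArg (actAt · y hy s) (add_zero 0)).symm.trans
    (actAt_add (f := f) 0 0 y hy s))

theorem IsFractionOn.add {f : CoordRing} {U V W : P2.Opens} {D E : Γ(logTangentSheaf f, U)}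
    {a : Fin 3 → CoordRing} {k : ℕ} (hD : IsFractionOn D a k V) (hE : IsFractionOn E a k W) :
    IsFractionOn (D + E) a k (V ⊓ W) := by
  obtain ⟨n₁, n₁', p₁, q₁, h₁, hp₁, hq₁, H₁⟩ := hD
  obtain ⟨n₂, n₂', p₂, q₂, h₂, hp₂, hq₂, H₂⟩ := hE
  refine ⟨n₁ + n₂', n₁' + n₂', p₁ * q₂ + p₂ * q₁, q₁ * q₂, by omega, (hp₁.mul hq₂).add ?_,
    hq₁.mul hq₂, fun y hyW hy => ?_⟩
  · have := hp₂.mul hq₁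
    rwa [show n₂ + n₁' = n₁ + n₂' by omega] at this
  · obtain ⟨hy₁, H₁⟩ := H₁ y hyW.1 hy
    obtain ⟨hy₂, H₂⟩ := H₂ y hyW.2 hy
    refine ⟨mul_notMem hy₁ hy₂, fun s => ?_⟩
    have h1 := toFrac_ne_zero (ne_zero_of_notMem hy₁)
    have h2 := toFrac_ne_zero (ne_zero_of_notMem hy₂)
    rw [actAt_add, H₁, H₂, map_add, map_mul, map_mul, map_mul]
    field_simp

theorem IsFractionOn.smul {f : CoordRing} {U V : P2.Opens} {D : Γ(logTangentSheaf f, U)}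
    {a : Fin 3 → CoordRing} {k : ℕ} (hD : IsFractionOn D a k V) (r : Γ(P2, U)) {x : P2}
    (hxU : x ∈ U) (hxV : x ∈ V) : ∃ W : P2.Opens, x ∈ W ∧ IsFractionOn (r • D) a k W := by
  obtain ⟨n, n', p, q, h, hp, hq, H⟩ := hD
  obtain ⟨W, hW, l, b, c, hx, hb, hc, hr⟩ := exists_local_fraction r hxU
  refine ⟨V ⊓ W, ⟨hxV, hx⟩, l + n, l + n', b * p, c * q, by omega, hb.mul hp, hc.mul hq,
    fun y hyW hy => ?_⟩
  obtain ⟨hqy, H⟩ := H y hyW.1 hy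
  obtain ⟨hcy, hr⟩ := hr y hyW.2 hy
  refine ⟨mul_notMem hcy hqy, fun s => ?_⟩
  rw [actAt_smul, hr, H, map_mul, map_mul, ← mul_assoc, div_mul_div_comm]

/-- The subsheaf of the logarithmic vector fields that are multiples of `∑ aⱼ ∂ⱼ`. -/
def multipleSheaf (f : CoordRing) (a : Fin 3 → CoordRing) (k : ℕ) :
    Subsheaf (logTangentSheaf f) where
  sections U :=
    { carrier := {D | ∀ x ∈ U, ∃ V : P2.Opens, x ∈ V ∧ IsFractionOn D a k V}
      zero_mem' := fun x _ => by
        obtain ⟨i, hi⟩ := exists_mem_chart x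
        exact ⟨chart i, hi, isFractionOn_zero a k i⟩
      add_mem' := fun hD hE x hx => by
        obtain ⟨V, hV, hDV⟩ := hD x hx
        obtain ⟨W, hW, hEW⟩ := hE x hx
        exact ⟨V ⊓ W, ⟨hV, hW⟩, hDV.add hEW⟩
      smul_mem' := fun r D hD x hx => by
        obtain ⟨V, hV, hDV⟩ := hD x hx
        exact hDV.smul r hx hV }
  res_mem {U V} h D hD x hx := by
    obtain ⟨W, hW, n, n', p, q, h', hp, hq, H⟩ := hD x (h hx)
    exact ⟨W, hW, n, n', p, q, h', hp, hq, fun y hy hyV => H y hy (h hyV)⟩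
  locality U D hD x hx := by
    obtain ⟨V, h, hxV, hDV⟩ := hD x hx
    obtain ⟨W, hW, n, n', p, q, h', hp, hq, H⟩ := hDV x hxV
    exact ⟨V ⊓ W, ⟨hxV, hW⟩, n, n', p, q, h', hp, hq, fun y hy _ => H y hy.2 hy.1⟩

/-- The chart fields of multiples of `a` are sections of the subsheaf generated by `a`. -/
theorem isFractionOn_chartField {f : CoordRing} {a b : Fin 3 → CoordRing} {h : CoordRing}
    {k l m : ℕ} (hb : b ∈ syz f (m + 1)) (hh : h.IsHomogeneous l) (hlk : l + k = m + 1)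
    (hba : b = fun j => h * a j) (i : Fin 3) : IsFractionOn (chartField hb i) a k (chart i) := by
  subst hba
  refine ⟨l, m, h, X i ^ m, hlk, hh, isHomogeneous_X_pow i m,
    fun y _ hy => ⟨pow_notMem hy m, fun s => ?_⟩⟩
  rw [actAt_chartField, chartDer_smul, chartDer_apply, ← mul_assoc, div_eq_mul_inv]

/-- On the chart X i ≠ 0 a single field generates: X i ^ (1 - k) ∑ aⱼ∂ⱼ. -/
theorem multipleSheaf_isCoherent {f : CoordRing} {a : Fin 3 → CoordRing} {k : ℕ}
    (ha : a ∈ syz f k) : (multipleSheaf f a k).IsCoherent := by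
  intro x
  obtain ⟨i, hi⟩ := exists_mem_chart x
  -- The extra factor X i makes the degree k + 1, so that `chartField` applies also for k = 0.
  have hXa : (fun j => X i * a j) ∈ syz f (k + 1) :=
    ⟨fun j => add_comm 1 k ▸ (isHomogeneous_X ℂ i).mul (ha.1 j), by
      simp only [mul_assoc, ← Finset.mul_sum, ha.2, mul_zero]⟩
  refine ⟨chart i, hi, 1, fun _ => chartField hXa i, fun _ y hy => ⟨chart i, hy,
    isFractionOn_chartField hXa (isHomogeneous_X ℂ i) (add_comm 1 k) rfl i⟩,
    fun V hV t ht y hy => ?_⟩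
  obtain ⟨W, hyW, n, n', p, q, h, hp, hq, H⟩ := ht y hy
  choose g hg using fun (z : P2) (hz : z ∈ V ⊓ W) =>
    exists_germ (hp.mul (isHomogeneous_X_pow i k))
      ((show n' + 1 = n + k from h.symm) ▸ hq.mul (isHomogeneous_X ℂ i))
      (mul_notMem (H z hz.2 hz.1).1 (hV hz.1))
  -- The coefficient relative to the generator is r = p X i ^ k / (q X i), of degree 0 by the
  -- equation n + k = n' + 1.
  obtain ⟨r, hr⟩ := exists_section g fun z hz => ⟨V ⊓ W, le_rfl, n + k, _, _, hz,
    hp.mul (isHomogeneous_X_pow i k), h.symm ▸ hq.mul (isHomogeneous_X ℂ i),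
    fun z' _ hz' => ⟨mul_notMem (H z' hz'.2 hz'.1).1 (hV hz'.1), hg z' hz'⟩⟩
  refine ⟨V ⊓ W, inf_le_left, ⟨hy, hyW⟩, ?_⟩
  have hWV : V ⊓ W ≤ V := inf_le_left
  have heq : res (logTangentSheaf f) hWV t =
      r • res (logTangentSheaf f) (hWV.trans hV) (chartField hXa i) := by
    refine section_eq_iff.mpr fun z hz s => ?_
    have hqz := toFrac_ne_zero (ne_zero_of_notMem (H z hz.2 hz.1).1)
    have hXi := toFrac_X_ne_zero i
    rw [actAt_smul, actAt_res, actAt_res, (H z hz.2 hz.1).2, hr, hg, actAt_chartField,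
      chartDer_smul, chartDer_apply]
    simp only [map_mul, map_pow]
    field_simp
  rw [heq]
  exact Submodule.smul_mem _ _ (Submodule.subset_span ⟨0, rfl⟩)

/-- The sections of the twists of the subsheaf generated by a primitive syzygy. -/
theorem formSections_multipleSheaf {f : CoordRing} {d : ℕ} (hd : d ≠ 0) (hhom : f.IsHomogeneous d)
    (hf0 : f ≠ 0) {a : Fin 3 → CoordRing} {k : ℕ} (ha : a ∈ syz f k)
    (hprim : ∀ p, Prime p → ∃ i, ¬ p ∣ a i) {i : Fin 3} (hai : a i ≠ 0) {m : ℕ} (hkm : k ≤ m) :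
    formSections (multipleSheaf f a k) m = multiples a (m + 1 - k) := by
  refine le_antisymm (fun b hb => ?_) ?_
  · obtain ⟨hb, hmem⟩ := mem_formSections.mp hb
    obtain ⟨x, hx⟩ := exists_generic_point
    obtain ⟨V, hxV, n, n', p, q, h, hp, hq, H⟩ := hmem 0 x (hx 0)
    obtain ⟨hqx, H⟩ := H x hxV (hx 0)
    have hq0 := ne_zero_of_notMem hqx
    -- Equal action on ratios determines the fields only modulo the Euler field, so q b - p X₀ᵐ a is
    -- merely proportional to (X₀, X₁, X₂).
    have hv : ∀ j, (q * b j - p * X 0 ^ m * a j) * X 0 =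
        (q * b 0 - p * X 0 ^ m * a 0) * X j := fun j => by
      have h1 := H (sectionAt (ratio 0 j) x (hx 0))
      have h2 : fracDer (polyDer a) (toFrac (X j) / toFrac (X 0)) = chartDer a 0 0 _ :=
        ((chartDer_apply a 0 0 _).trans (by rw [pow_zero, map_one, inv_one, one_mul])).symm
      rw [actAt_chartField, germToFrac_ratio, h2, chartDer_ratio, chartDer_ratio] at h1
      have hX := toFrac_X_ne_zero 0
      have hq' := toFrac_ne_zero hq0
      refine toFrac_injective (mul_left_cancel₀ (pow_ne_zero 2 hX) ?_)
      field_simp at h1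
      simp only [map_sub, map_mul, map_pow] at h1 ⊢
      linear_combination h1
    have hsum : ∑ j, (q * b j - p * X 0 ^ m * a j) * pderiv j f = 0 := by
      simp only [sub_mul, Finset.sum_sub_distrib, mul_assoc, ← Finset.mul_sum]
      rw [show ∑ j, b j * pderiv j f = 0 from hb.2, show ∑ j, a j * pderiv j f = 0 from ha.2]
      simp
    -- The difference is also a syzygy, and Euler's relation leaves no nonzero syzygy proportional
    -- to the coordinates.
    have hv0 : q * b 0 - p * X 0 ^ m * a 0 = 0 := by
      have h1 : (q * b 0 - p * X 0 ^ m * a 0) * (d • f) = 0 := by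
        rw [← hhom.sum_X_mul_pderiv, Finset.mul_sum]
        simp only [← mul_assoc, ← hv]
        rw [← zero_mul (X 0), ← hsum, Finset.sum_mul]
        exact Finset.sum_congr rfl fun j _ => by ring
      exact (mul_eq_zero.mp h1).resolve_right (smul_ne_zero hd hf0)
    have hqb : ∀ j, q * b j = p * X 0 ^ m * a j := fun j => by
      have := hv j
      rw [hv0, zero_mul] at this
      exact sub_eq_zero.mp ((mul_eq_zero.mp this).resolve_right (X_ne_zero 0))
    obtain ⟨w, hw⟩ := exists_eq_mul_of_proportional hprim hai (v := b) fun j l =>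
      mul_left_cancel₀ hq0 (by rw [← mul_assoc, ← mul_assoc, hqb, hqb]; ring)
    refine ⟨w, isHomogeneous_of_mul (ha.1 i) ?_ hai, funext fun j => (hw j).symm⟩
    rw [← hw, Nat.sub_add_cancel (by omega)]
    exact hb.1 i
  · rintro _ ⟨h, hh, rfl⟩
    have hdeg : m + 1 - k + k = m + 1 := by omega
    have hb : mulVec a h ∈ syz f (m + 1) :=
      ⟨fun j => hdeg ▸ IsHomogeneous.mul hh (ha.1 j), by
        simp only [mulVec_apply, mul_assoc, ← Finset.mul_sum, ha.2, mul_zero]⟩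
    exact mem_formSections.mpr ⟨hb, fun i x hx => ⟨chart i, hx,
      isFractionOn_chartField hb hh hdeg rfl i⟩⟩

/-- A primitive syzygy of degree `k` gives a subsheaf of rank one and slope `1 - k`. -/
theorem isHilbertPolynomial_multipleSheaf {f : CoordRing} {d : ℕ} (hd : d ≠ 0)
    (hhom : f.IsHomogeneous d) (hf0 : f ≠ 0) {a : Fin 3 → CoordRing} {k : ℕ} (ha : a ∈ syz f k)
    (hprim : ∀ p, Prime p → ∃ i, ¬ p ∣ a i) {i : Fin 3} (hai : a i ≠ 0) :
    (multipleSheaf f a k).IsHilbertPolynomial (twistPoly (1 - k)) := by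
  rw [isHilbertPolynomial_iff hd hhom hf0]
  filter_upwards [Filter.eventually_ge_atTop k] with m hkm
  rw [formSections_multipleSheaf hd hhom hf0 ha hprim hai hkm, finrank_multiples hai,
    twistPoly_eval (n := m + 1 - k) (by rw [Nat.cast_sub (by omega)]; push_cast; ring)]

/-! ### The stability criterion. -/

theorem rank_twistPoly (c : ℚ) : rank (twistPoly c) = 1 := by
  rw [rank, twistPoly_coeff_two]
  norm_num

theorem slope_twistPoly (c : ℚ) : slope (twistPoly c) = c := by
  rw [slope, degree, rank_twistPoly, twistPoly_coeff_one]
  ring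

/-- Dividing out the common factor leaves a primitive syzygy of some degree k ≤ e. Its rank one
subsheaf has slope 1 - k ≥ 1 - e ≥ (3 - d)/2, so it destabilizes. -/
theorem not_isStable_of_hasSyzygy {f : CoordRing} {d : ℕ} (hd : d ≠ 0) (hhom : f.IsHomogeneous d)
    (hred : Squarefree f) {e : ℕ} (hde : 2 * e + 1 ≤ d) (h : HasSyzygy f e) :
    ¬ IsStable (logTangentSheaf f) := by
  rintro ⟨p, hp, hstable⟩
  obtain ⟨b, hbhom, hb0, hb⟩ := h
  obtain ⟨k, l, g, a, hkl, hg, hg0, ha, hba, hprim⟩ := exists_primitive hbhom hb0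
  obtain ⟨i, hbi⟩ : ∃ i, b i ≠ 0 := by
    by_contra! h
    exact hb0 (funext h)
  have hai : a i ≠ 0 := right_ne_zero_of_mul (hba i ▸ hbi)
  have hasyz : a ∈ syz f k := by
    refine ⟨ha, (mul_eq_zero.mp ?_).resolve_left hg0⟩
    rw [Finset.mul_sum, ← hb]
    exact Finset.sum_congr rfl fun j _ => by rw [hba, mul_assoc]
  obtain ⟨p', hp', -, hrank, hslope⟩ := exists_isHilbertPolynomial_whole hd hhom hred
  have hpp : p = p' := eq_of_eventually_eval_eq <| by
    filter_upwards [hp, hp'] with m h1 h2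
    rw [← h1.2, ← h2.2]
  have := hstable _ (multipleSheaf_isCoherent hasyz) _
    (isHilbertPolynomial_multipleSheaf hd hhom hred.ne_zero hasyz hprim hai)
    (by rw [rank_twistPoly]; norm_num) (by rw [rank_twistPoly, hpp, hrank]; norm_num)
  rw [slope_twistPoly, hpp, hslope] at this
  have h1 : (k : ℚ) ≤ e := by exact_mod_cast (by omega : k ≤ e)
  have h2 : 2 * (e : ℚ) + 1 ≤ d := by exact_mod_cast hde
  linarith

end PlaneCurve

end

theorem proposition2p4 (d : ℕ) (hd : 4 ≤ d) (f : PlaneCurve.CoordRing)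
    (hhom : f.IsHomogeneous d) (hred : Squarefree f) :
    (PlaneCurve.IsStable (PlaneCurve.logTangentSheaf f) ↔
      ¬ PlaneCurve.HasSyzygy f ((d - 1) / 2)) ∧
    (PlaneCurve.IsNonsingular f → PlaneCurve.IsStable (PlaneCurve.logTangentSheaf f)) := by
  have hd0 : d ≠ 0 := by omega
  have h : PlaneCurve.IsStable (PlaneCurve.logTangentSheaf f) ↔
      ¬ PlaneCurve.HasSyzygy f ((d - 1) / 2) := by
    -- The floor e = (d - 1) / 2 satisfies 2e + 1 ≤ d, needed here, and d ≤ 2e + 2, needed for the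
    -- converse; equality holds in the first for odd d and in the second for even d.
    refine ⟨fun hs he => PlaneCurve.not_isStable_of_hasSyzygy hd0 hhom hred (by omega) he hs,
      fun he => ?_⟩
    obtain ⟨p, hp, -, hrank, hslope⟩ := PlaneCurve.exists_isHilbertPolynomial_whole hd0 hhom hred
    refine ⟨p, hp, fun F _ q hq hq0 hqp => ?_⟩
    rw [hslope]
    exact PlaneCurve.slope_lt_of_not_hasSyzygy hd0 hhom hred (by omega) he hq hq0 (hrank ▸ hqp)
  exact ⟨h, fun hns => h.mpr (PlaneCurve.not_hasSyzygy_of_isNonsingular (by omega) hhom hns)⟩
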